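/- Let $\sigma(z)=1/(1+e^{-z})$, and let $\varphi:\mathbb R\to\mathbb R$ be any continuous sigmoidal activation function, i.e. $\varphi(z)\to 0$ as $z\to-\infty$ and $\varphi(z)\to 1$ as $z\to+\infty$. A neural network is a map $z\mapsto A\,\varphi(Wz+\theta)+c$ with one hidden layer of finitely many units, where $\varphi$ acts componentwise. Let $U\subset\mathbb R^m$ be open, let $X$ be a random vector in $U$ whose law has a density that is positive and continuous on $U$, and let $Y$ be a random vector in $\mathbb R^m$ whose law has a density that is positive and continuous on $\mathbb R^m$. Let $-\infty\le r_0<r_1\le\infty$ be such that $U\subset(r_0,r_1)^m$. Then there is a sequence $(K_n)_{n\ge1}$ of autoregressive maps $\mathbb R^m\to\mathbb R^m$ of the form $$K_n(x)_t=\sigma^{-1}\Bigl(\sum_{j=1}^{n}w_{tj}(x_{1:t-1})\,\sigma\Bigl(\frac{x_t-b_{tj}(x_{1:t-1})}{\tau_{tj}(x_{1:t-1})}\Bigr)\Bigr),\qquad 1\le t\le m,$$ where (for each $n$ and $t$) $w_{t\cdot}$ is the softmax of the output of a neural network with input $x_{1:t-1}$, $b_{t\cdot}$ is the output of such a network, and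 $\tau_{t\cdot}$ is the componentwise exponential of the output of such a network, such that 1. for all $n$, $t$, $j$ and all $x\in U$: $w_{tj}>0$, $\sum_j w_{tj}=1$, $b_{tj}\in(r_0,r_1)$ and $\tau_{tj}>0$, and for each $n$ the functions $\tau_{tj}$ are bounded on $U$; 2. $K_n(X)$ converges in distribution to $Y$. -/

import Mathlib

open MeasureTheory Filter
open scoped Topology

/-- A feedforward neural network with `k` real inputs, one hidden layer of `width` units and `p`
real outputs. The activation function is supplied when the network is evaluated. -/
structure NeuralNet (k p : ℕ) where
  width : ℕ
  innerWeight : Fin width → Fin k → ℝ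
  innerBias : Fin width → ℝ
  outerWeight : Fin p → Fin width → ℝ
  outerBias : Fin p → ℝ

/-- The function computed by the network with activation function `φ`:
`z ↦ A φ(W z + θ) + c`, where `φ` acts on each hidden unit. -/
def NeuralNet.eval {k p : ℕ} (φ : ℝ → ℝ) (N : NeuralNet k p) (z : Fin k → ℝ) : Fin p → ℝ :=
  fun j => ∑ i, N.outerWeight j i * φ (∑ l, N.innerWeight i l * z l + N.innerBias i)
    + N.outerBias j

/-- A continuous sigmoidal activation function. -/
structure IsSigmoidal (φ : ℝ → ℝ) : Prop where
  continuous : Continuous φ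
  tendsto_atBot : Tendsto φ atBot (𝓝 0)
  tendsto_atTop : Tendsto φ atTop (𝓝 1)

/-- The softmax function. -/
noncomputable def softmax {d : ℕ} (v : Fin d → ℝ) : Fin d → ℝ :=
  fun j => Real.exp (v j) / ∑ i, Real.exp (v i)

/-- The inverse sigmoid function `σ⁻¹`, meaningful on `(0, 1)`. -/
noncomputable def logit (p : ℝ) : ℝ := Real.log (p / (1 - p))

theorem logit_sigmoid (x : ℝ) : logit (Real.sigmoid x) = x := by
  have h : Real.sigmoid x / (1 - Real.sigmoid x) = Real.exp x := by
    have h0 : Real.exp x ≠ 0 := (Real.exp_pos x).ne'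
    have h1 : (1 : ℝ) + (Real.exp x)⁻¹ ≠ 0 := by positivity
    rw [Real.sigmoid_def, Real.exp_neg]
    field_simp
    ring
  rw [logit, h, Real.log_exp]

theorem sigmoid_logit {p : ℝ} (h0 : 0 < p) (h1 : p < 1) : Real.sigmoid (logit p) = p := by
  have h2 : 0 < 1 - p := by linarith
  rw [logit, Real.sigmoid_def, Real.exp_neg, Real.exp_log (by positivity)]
  field_simp
  ring

/-- `x_{1:t-1}`: the coordinates of `x` strictly before position `t` (positions are counted
from `0` here). -/
def prefixOf {m : ℕ} (x : Fin m → ℝ) (t : Fin m) : Fin (t : ℕ) → ℝ :=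
  fun i => x (Fin.castLE t.isLt.le i)

/-- An autoregressive conditioner for a deep sigmoidal flow on `ℝ^m` with `d` sigmoid units:
for every position `t`, neural networks that take `x_{1:t-1}` as input and output the
unconstrained pseudo-parameters of the `d` units of the `t`-th transformer. -/
structure Conditioner (m d : ℕ) where
  weightNet : (t : Fin m) → NeuralNet (t : ℕ) d
  centerNet : (t : Fin m) → NeuralNet (t : ℕ) d
  scaleNet : (t : Fin m) → NeuralNet (t : ℕ) d

namespace Conditioner

variable {m d : ℕ}

/-- The weights `w_{tj}(x_{1:t-1})`. -/
noncomputable def w (φ : ℝ → ℝ) (C : Conditioner m d) (t : Fin m) (x : Fin m → ℝ) : Fin d → ℝ :=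
  softmax ((C.weightNet t).eval φ (prefixOf x t))

/-- The centers `b_{tj}(x_{1:t-1})`. -/
def b (φ : ℝ → ℝ) (C : Conditioner m d) (t : Fin m) (x : Fin m → ℝ) : Fin d → ℝ :=
  (C.centerNet t).eval φ (prefixOf x t)

/-- The scales `τ_{tj}(x_{1:t-1})`. -/
noncomputable def τ (φ : ℝ → ℝ) (C : Conditioner m d) (t : Fin m) (x : Fin m → ℝ) : Fin d → ℝ :=
  fun j => Real.exp ((C.scaleNet t).eval φ (prefixOf x t) j)

/-- The pre-logit `∑_j w_{tj}(x_{1:t-1}) σ((x_t - b_{tj}(x_{1:t-1})) / τ_{tj}(x_{1:t-1}))`. -/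
noncomputable def preLogit (φ : ℝ → ℝ) (C : Conditioner m d) (x : Fin m → ℝ) : Fin m → ℝ :=
  fun t => ∑ j, C.w φ t x j * Real.sigmoid ((x t - C.b φ t x j) / C.τ φ t x j)

/-- The deep sigmoidal flow `ℝ^m → ℝ^m` with conditioner `C`. -/
noncomputable def flow (φ : ℝ → ℝ) (C : Conditioner m d) (x : Fin m → ℝ) : Fin m → ℝ :=
  fun t => logit (C.preLogit φ x t)

end Conditioner

/-- `X` is a random vector whose law is carried by `U` and has a density with respect to Lebesgue
measure that is positive and continuous on `U`. -/
def HasPositiveContinuousDensity {Ω : Type*} [MeasurableSpace Ω] {m : ℕ}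
    (X : Ω → Fin m → ℝ) (P : Measure Ω) (U : Set (Fin m → ℝ)) : Prop :=
  AEMeasurable X P ∧ ∃ p : (Fin m → ℝ) → ℝ,
    ContinuousOn p U ∧ (∀ x ∈ U, 0 < p x) ∧
      P.map X = (volume.restrict U).withDensity (fun x => ENNReal.ofReal (p x))

/-! ### Universal approximation on compact sets for continuous sigmoidal activations -/

section UniversalApproximation

variable {φ : ℝ → ℝ} {k : ℕ}

/-! Replace Y by σ(Y), which lives in the open unit cube. The Knothe–Rosenblatt rearrangement
supplies an autoregressive map S, monotone in the current coordinate, that pushes the law of X to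
the law of σ(Y) (`exists_autoregressive_map_eq`). It is enough that the pre-logits of the flows tend
to S in measure under the law of X: almost surely S(X) lies in the open cube, where the logit is
continuous, so the flows converge in measure to logit S(X), whose law is that of Y.

Consider one coordinate of S with the prefix fixed. A monotone function into [0,1] is recovered at
its continuity points by steep sigmoids centered on a fine grid and weighted by the increments of
the function (`tendsto_sum_stepWeight_mul_sigmoid`). The function may jump, but only countably
often, and the conditional laws of the coordinates of X are atomless because the law of X is
absolutely continuous (`ae_nullSingletonClass_of_compProd`); the jumps are therefore invisible. Grid
and steepness do not depend on the prefix, so constant networks serve for centers and scales, and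
only the weights have to be learned.

The weights are merely measurable in the prefix. A small uniform admixture keeps them away from 0,
so their logarithms are bounded; these are approximated almost everywhere by continuous functions,
hence by networks, and the softmax undoes the logarithm (`exists_neuralNet_measure_softmax_le`). The
underlying universal approximation theorem comes from writing exp of a linear form as a
superposition of step functions, followed by Stone–Weierstrass (`topologicalClosure_ridgeSpan`). -/

theorem IsSigmoidal.exists_abs_le (hφ : IsSigmoidal φ) : ∃ B, ∀ x, |φ x| ≤ B := by
  obtain ⟨a, ha⟩ := (hφ.tendsto_atBot.abs.eventually_le_const
    (show |(0 : ℝ)| < 2 by norm_num)).exists_forall_of_atBot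
  obtain ⟨b, hb⟩ := (hφ.tendsto_atTop.abs.eventually_le_const
    (show |(1 : ℝ)| < 2 by norm_num)).exists_forall_of_atTop
  obtain ⟨C, hC⟩ := (isCompact_Icc (a := a) (b := b)).exists_bound_of_continuousOn
    hφ.continuous.continuousOn
  refine ⟨max C 2, fun x => ?_⟩
  rcases le_total x a with h | h
  · exact (ha x h).trans (le_max_right _ _)
  rcases le_total b x with h' | h'
  · exact (hb x h').trans (le_max_right _ _)
  · exact (hC x ⟨h, h'⟩).trans (le_max_left _ _)

/-- Rescaled copies of a sigmoidal function converge to the Heaviside function in `L¹`. -/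
theorem IsSigmoidal.tendsto_integral_abs_sub_heaviside (hφ : IsSigmoidal φ) (L : ℝ) :
    Tendsto (fun n : ℕ => ∫ v in Set.Ioc (-L) L,
      |φ ((n : ℝ) * v) - (Set.Ioi (0 : ℝ)).indicator 1 v|) atTop (𝓝 0) := by
  obtain ⟨B, hB⟩ := hφ.exists_abs_le
  have hm : Measurable ((Set.Ioi (0 : ℝ)).indicator (1 : ℝ → ℝ)) :=
    measurable_one.indicator measurableSet_Ioi
  suffices h : Tendsto (fun n : ℕ => ∫ v in Set.Ioc (-L) L,
      |φ ((n : ℝ) * v) - (Set.Ioi (0 : ℝ)).indicator 1 v|) atTop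
      (𝓝 (∫ v in Set.Ioc (-L) L, (0 : ℝ))) by simpa using h
  refine tendsto_integral_of_dominated_convergence (fun _ => B + 1) ?_ ?_ ?_ ?_
  · intro n
    have := hφ.continuous.measurable
    exact (((this.comp (measurable_const.mul measurable_id)).sub hm).abs).aestronglyMeasurable
  · exact integrable_const _
  · intro n
    refine Eventually.of_forall fun v => ?_
    rw [Real.norm_eq_abs, abs_abs]
    refine (abs_sub _ _).trans (add_le_add (hB _) ?_)
    by_cases hv : v ∈ Set.Ioi (0 : ℝ) <;> simp [hv]
  -- At v = 0 the integrand is the constant |φ 0|, so this single point has to be discarded.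
  · have hne : ∀ᵐ v ∂(volume.restrict (Set.Ioc (-L) L)), v ≠ (0 : ℝ) :=
      ae_restrict_of_ae (by simp [ae_iff])
    filter_upwards [hne] with v hv
    have hn : Tendsto (fun n : ℕ => (n : ℝ)) atTop atTop := tendsto_natCast_atTop_atTop
    rcases lt_or_gt_of_ne hv with h | h
    · have h1 := hφ.tendsto_atBot.comp (hn.atTop_mul_const_of_neg h)
      have hv' : v ∉ Set.Ioi (0 : ℝ) := by simp [h.le]
      simpa [Set.indicator_of_notMem hv', Function.comp_def] using h1.abs
    · have h1 := hφ.tendsto_atTop.comp (hn.atTop_mul_const h)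
      have hv' : v ∈ Set.Ioi (0 : ℝ) := h
      simpa [Set.indicator_of_mem hv', Function.comp_def] using (h1.sub_const 1).abs

theorem continuous_restrict_linearForm (K : Set (Fin k → ℝ)) (w : Fin k → ℝ) :
    Continuous fun x : K => ∑ l, w l * (x : Fin k → ℝ) l :=
  continuous_finsetSum _ fun l _ =>
    continuous_const.mul ((continuous_apply l).comp continuous_subtype_val)

/-- The function computed by a hidden unit, as a continuous function on `K`; the index `none`
stands for the constant function `1`. -/
def ridge (hφ : Continuous φ) (K : Set (Fin k → ℝ)) : Option ((Fin k → ℝ) × ℝ) → C(K, ℝ)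
  | none => 1
  | some p => ⟨fun x => φ (∑ l, p.1 l * (x : Fin k → ℝ) l + p.2),
      hφ.comp ((continuous_restrict_linearForm K p.1).add_const _)⟩

/-- The restrictions to `K` of scalar functions computed by neural networks. -/
def ridgeSpan (hφ : Continuous φ) (K : Set (Fin k → ℝ)) : Submodule ℝ C(K, ℝ) :=
  Submodule.span ℝ (Set.range (ridge hφ K))

/-- All outputs share one hidden layer, the union of the finitely many units used by each; the
coefficient of `none` becomes the outer bias. -/
theorem exists_neuralNet_of_mem_ridgeSpan (hφ : Continuous φ) (K : Set (Fin k → ℝ)) {p : ℕ}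
    (f : Fin p → C(K, ℝ)) (hf : ∀ j, f j ∈ ridgeSpan hφ K) :
    ∃ N : NeuralNet k p, ∀ (z : K) (j : Fin p), N.eval φ z j = f j z := by
  classical
  have h : ∀ j, ∃ c : Option ((Fin k → ℝ) × ℝ) →₀ ℝ,
      (c.sum fun i a => a • ridge hφ K i) = f j := fun j =>
    (Finsupp.mem_span_range_iff_exists_finsupp).1 (hf j)
  choose c hc using h
  let T : Finset (Option ((Fin k → ℝ) × ℝ)) := Finset.univ.biUnion fun j => (c j).support
  let s : Finset ((Fin k → ℝ) × ℝ) := Finset.eraseNone T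
  refine ⟨⟨s.card, fun i => (s.equivFin.symm i).1.1, fun i => (s.equivFin.symm i).1.2,
    fun j i => c j (some (s.equivFin.symm i).1), fun j => c j none⟩, fun z j => ?_⟩
  have hsub : (c j).support ⊆ Finset.insertNone s := by
    intro o ho
    have hT : o ∈ T := Finset.mem_biUnion.2 ⟨j, Finset.mem_univ _, ho⟩
    cases o with
    | none => simp
    | some q => simpa [s] using hT
  rw [← hc j, Finsupp.sum_of_support_subset _ hsub _ (by simp)]
  simp only [Finset.sum_insertNone, ContinuousMap.add_apply, ContinuousMap.sum_apply,
    ContinuousMap.smul_apply, NeuralNet.eval, smul_eq_mul]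
  rw [add_comm]
  congr 1
  · simp [ridge]
  · rw [← Finset.sum_coe_sort s]
    exact Fintype.sum_equiv s.equivFin.symm _ _ fun i => rfl

/-- An average of points of a closed convex set stays in it, and a subspace absorbs the length of
the interval. -/
theorem Submodule.integral_Ioc_mem_of_isClosed {E : Type*} [NormedAddCommGroup E]
    [NormedSpace ℝ E] [CompleteSpace E] (M : Submodule ℝ E) (hM : IsClosed (M : Set E)) {a b : ℝ}
    (hab : a < b) (f : ℝ → E) (hf : Continuous f) (h : ∀ u, f u ∈ M) :
    ∫ u in Set.Ioc a b, f u ∈ M := by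
  have h1 : (⨍ u in Set.Ioc a b, f u) ∈ (M : Set E) := by
    refine Convex.set_average_mem M.convex hM (by simp [hab]) (by simp)
      (Eventually.of_forall h) ?_
    exact (hf.integrableOn_Icc).mono_set Set.Ioc_subset_Icc_self
  have h2 := M.smul_mem (volume.real (Set.Ioc a b)) h1
  rwa [measure_smul_setAverage _ (by simp)] at h2

/-- For a linear form ℓ with values in (-L, L), exp ℓ = e^{-L} + ∫ e^u 1[u < ℓ] du over (-L, L].
Replacing the indicator by φ(n(ℓ - u)) gives an integral of ridge functions, which lies in the
closed span, and the error is small uniformly in x. -/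
theorem exp_mem_topologicalClosure_ridgeSpan (hφ : IsSigmoidal φ) (K : Set (Fin k → ℝ))
    [CompactSpace K] (w : Fin k → ℝ) (E : C(K, ℝ))
    (hE : ∀ x : K, E x = Real.exp (∑ l, w l * (x : Fin k → ℝ) l)) :
    E ∈ (ridgeSpan hφ.continuous K).topologicalClosure := by
  set M := (ridgeSpan hφ.continuous K).topologicalClosure with hM
  have hMc : IsClosed (M : Set C(K, ℝ)) := Submodule.isClosed_topologicalClosure _
  have hmem : ∀ o, ridge hφ.continuous K o ∈ M := fun o =>
    Submodule.le_topologicalClosure _ (Submodule.subset_span ⟨o, rfl⟩)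
  let ℓ : C(K, ℝ) := ⟨_, continuous_restrict_linearForm K w⟩
  set L : ℝ := ‖ℓ‖ + 1 with hL
  have hL0 : 0 < L := by positivity
  have hℓ : ∀ x, |ℓ x| < L := fun x => (ℓ.norm_coe_le_norm x).trans_lt (lt_add_one _)
  let R : ℕ → ℝ → C(K, ℝ) := fun n u =>
    Real.exp u • ridge hφ.continuous K (some (fun l => (n : ℝ) * w l, -(n * u)))
  have hRapp : ∀ n u x, R n u x = Real.exp u * φ (n * (ℓ x - u)) := by
    intro n u x
    simp only [R, ContinuousMap.smul_apply, smul_eq_mul, ridge, ContinuousMap.coe_mk, ℓ]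
    congr 2
    rw [mul_sub, Finset.mul_sum, sub_eq_add_neg]
    simp [mul_assoc]
  have hRc : ∀ n, Continuous (R n) := by
    intro n
    refine ContinuousMap.continuous_of_continuous_uncurry _ ?_
    have : (Function.uncurry fun u x => R n u x)
        = fun q : ℝ × K => Real.exp q.1 * φ (n * (ℓ q.2 - q.1)) := by
      ext q; exact hRapp n q.1 q.2
    rw [this]
    have := hφ.continuous
    fun_prop
  let G : ℕ → C(K, ℝ) := fun n => ∫ u in Set.Ioc (-L) L, R n u
  have hG : ∀ n, G n ∈ M := fun n =>
    M.integral_Ioc_mem_of_isClosed hMc (by linarith) _ (hRc n) fun u => M.smul_mem _ (hmem _)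
  have hGapp : ∀ n x, G n x = ∫ u in Set.Ioc (-L) L, Real.exp u * φ (n * (ℓ x - u)) := by
    intro n x
    have h := (ContinuousMap.evalCLM ℝ x : C(K, ℝ) →L[ℝ] ℝ).integral_comp_comm
      (((hRc n).integrableOn_Icc (μ := volume) (a := -L) (b := L)).mono_set
        Set.Ioc_subset_Icc_self)
    have h2 : G n x = (ContinuousMap.evalCLM ℝ x : C(K, ℝ) →L[ℝ] ℝ) (G n) := rfl
    rw [h2, ← h]
    exact integral_congr_ae (Eventually.of_forall fun u => hRapp n u x)
  let F : ℕ → C(K, ℝ) := fun n => G n + Real.exp (-L) • ridge hφ.continuous K none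
  have hF : ∀ n, F n ∈ M := fun n => M.add_mem (hG n) (M.smul_mem _ (hmem none))
  refine hMc.mem_of_tendsto (f := F) (b := atTop) ?_ (Eventually.of_forall hF)
  rw [tendsto_iff_norm_sub_tendsto_zero]
  -- Both ℓ x and u lie in [-L, L], so ℓ x - u stays in [-2L, 2L]; integrating over this larger
  -- window bounds the error independently of x.
  have hlim := (hφ.tendsto_integral_abs_sub_heaviside (2 * L)).const_mul (Real.exp L)
  rw [mul_zero] at hlim
  refine squeeze_zero (fun n => norm_nonneg _) (fun n => ?_) hlim
  have hm : Measurable ((Set.Ioi (0 : ℝ)).indicator (1 : ℝ → ℝ)) :=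
    measurable_one.indicator measurableSet_Ioi
  set D : ℝ → ℝ := fun v => |φ ((n : ℝ) * v) - (Set.Ioi (0 : ℝ)).indicator 1 v| with hD
  obtain ⟨B, hB⟩ := hφ.exists_abs_le
  have hφm := hφ.continuous.measurable
  have hDm : Measurable D :=
    ((hφm.comp (measurable_const.mul measurable_id)).sub hm).abs
  have hDb : ∀ v, ‖D v‖ ≤ B + 1 := by
    intro v
    rw [hD, Real.norm_eq_abs, abs_abs]
    refine (abs_sub _ _).trans (add_le_add (hB _) ?_)
    by_cases hv : v ∈ Set.Ioi (0 : ℝ) <;> simp [hv]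
  refine (ContinuousMap.norm_le _ (by positivity)).2 fun x => ?_
  have hx := abs_lt.1 (hℓ x)
  have hexp : E x - Real.exp (-L)
      = ∫ u in Set.Ioc (-L) L, Real.exp u * (Set.Ioi (0 : ℝ)).indicator 1 (ℓ x - u) := by
    have h1 : ∫ u in (-L)..(ℓ x), Real.exp u = Real.exp (ℓ x) - Real.exp (-L) := integral_exp
    have h2 : E x = Real.exp (ℓ x) := hE x
    rw [h2, ← h1, intervalIntegral.integral_of_le hx.1.le, integral_Ioc_eq_integral_Ioo]
    have h3 : (fun u => Real.exp u * (Set.Ioi (0 : ℝ)).indicator 1 (ℓ x - u))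
        = (Set.Iio (ℓ x)).indicator Real.exp := by
      ext u
      by_cases hu : u < ℓ x <;> simp [Set.indicator, hu]
    rw [h3, setIntegral_indicator measurableSet_Iio]
    congr 2
    ext u
    simp only [Set.mem_Ioo, Set.mem_inter_iff, Set.mem_Ioc, Set.mem_Iio]
    constructor
    · rintro ⟨h, h'⟩; exact ⟨⟨h, (h'.trans hx.2).le⟩, h'⟩
    · rintro ⟨⟨h, -⟩, h'⟩; exact ⟨h, h'⟩
  have hi1 : IntegrableOn (fun u => Real.exp u * φ (n * (ℓ x - u))) (Set.Ioc (-L) L) := by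
    have := hφ.continuous
    exact (Continuous.integrableOn_Icc (by fun_prop)).mono_set Set.Ioc_subset_Icc_self
  have hi2 : IntegrableOn (fun u => Real.exp u * (Set.Ioi (0 : ℝ)).indicator 1 (ℓ x - u))
      (Set.Ioc (-L) L) := by
    refine Integrable.mono' (g := Real.exp) ?_ ?_ ?_
    · exact (Continuous.integrableOn_Icc (by fun_prop)).mono_set Set.Ioc_subset_Icc_self
    · exact (Real.measurable_exp.mul
        (hm.comp (measurable_const.sub measurable_id))).aestronglyMeasurable
    · refine Eventually.of_forall fun u => ?_
      by_cases hu : u < ℓ x <;> simp [Set.indicator, hu, Real.exp_nonneg]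
  have hkey : (F n - E) x = ∫ u in Set.Ioc (-L) L,
      Real.exp u * (φ (n * (ℓ x - u)) - (Set.Ioi (0 : ℝ)).indicator 1 (ℓ x - u)) := by
    simp only [mul_sub (Real.exp _)]
    rw [integral_sub hi1 hi2, ← hexp]
    have : (F n - E) x = G n x + Real.exp (-L) - E x := by simp [F, ridge]
    rw [this, hGapp]
    ring
  rw [hkey]
  have hi3 : ∀ s : Set ℝ, volume s ≠ ⊤ → IntegrableOn (fun u => D (ℓ x - u)) s := fun s hs =>
    Measure.integrableOn_of_bounded hs
      (hDm.comp (measurable_const.sub measurable_id)).aestronglyMeasurable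
      (Eventually.of_forall fun u => hDb _)
  calc ‖∫ u in Set.Ioc (-L) L,
        Real.exp u * (φ (n * (ℓ x - u)) - (Set.Ioi (0 : ℝ)).indicator 1 (ℓ x - u))‖
      ≤ ∫ u in Set.Ioc (-L) L, Real.exp L * D (ℓ x - u) := by
        refine norm_integral_le_of_norm_le ((hi3 _ (by simp)).const_mul _) ?_
        filter_upwards [ae_restrict_mem measurableSet_Ioc] with u hu
        rw [norm_mul, Real.norm_eq_abs, Real.norm_eq_abs, Real.abs_exp]
        exact mul_le_mul_of_nonneg_right (Real.exp_le_exp.2 hu.2) (abs_nonneg _)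
    _ = Real.exp L * ∫ u in Set.Ioc (-L) L, D (ℓ x - u) := integral_const_mul _ _
    _ ≤ Real.exp L * ∫ v in Set.Ioc (-(2 * L)) (2 * L), D v := by
        refine mul_le_mul_of_nonneg_left ?_ (Real.exp_nonneg _)
        rw [← intervalIntegral.integral_of_le (by linarith),
          intervalIntegral.integral_comp_sub_left (fun v => D v),
          intervalIntegral.integral_of_le (by linarith)]
        refine setIntegral_mono_set ?_ (Eventually.of_forall fun v => abs_nonneg _) ?_
        · exact Measure.integrableOn_of_bounded (by simp) hDm.aestronglyMeasurable
            (Eventually.of_forall hDb)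
        · exact (Set.Ioc_subset_Ioc (by linarith) (by linarith)).eventuallyLE

/-- Exponentials of linear forms are closed under products, so the algebra they generate is just
their linear span; it separates points, and Stone–Weierstrass applies. -/
theorem topologicalClosure_ridgeSpan (hφ : IsSigmoidal φ) (K : Set (Fin k → ℝ)) [CompactSpace K] :
    (ridgeSpan hφ.continuous K).topologicalClosure = ⊤ := by
  let e : (Fin k → ℝ) → C(K, ℝ) := fun w =>
    ⟨fun x => Real.exp (∑ l, w l * (x : Fin k → ℝ) l),
      Real.continuous_exp.comp (continuous_restrict_linearForm K w)⟩
  let S : Submonoid C(K, ℝ) :=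
    { carrier := Set.range e
      one_mem' := ⟨0, by ext; simp [e]⟩
      mul_mem' := by
        rintro _ _ ⟨w, rfl⟩ ⟨w', rfl⟩
        refine ⟨w + w', ?_⟩
        ext x
        simp [e, add_mul, Finset.sum_add_distrib, Real.exp_add] }
  have hle : Subalgebra.toSubmodule (Algebra.adjoin ℝ (Set.range e))
      ≤ (ridgeSpan hφ.continuous K).topologicalClosure := by
    rw [Algebra.adjoin_eq_span]
    have : Submonoid.closure (Set.range e) = S := Submonoid.closure_eq S
    rw [this, Submodule.span_le]
    rintro _ ⟨w, rfl⟩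
    exact exp_mem_topologicalClosure_ridgeSpan hφ K w _ fun x => rfl
  have hsep : (Algebra.adjoin ℝ (Set.range e)).SeparatesPoints := by
    intro x y hxy
    obtain ⟨i, hi⟩ : ∃ i, (x : Fin k → ℝ) i ≠ (y : Fin k → ℝ) i := by
      by_contra! h
      exact hxy (Subtype.ext (funext h))
    refine ⟨_, ⟨e (Pi.single i 1), Algebra.subset_adjoin ⟨_, rfl⟩, rfl⟩, ?_⟩
    simpa [e, Pi.single_apply] using hi
  have htop := ContinuousMap.subalgebra_topologicalClosure_eq_top_of_separatesPoints _ hsep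
  rw [eq_top_iff]
  intro f _
  have hf : f ∈ (Algebra.adjoin ℝ (Set.range e)).topologicalClosure := by rw [htop]; trivial
  have hf' : f ∈ closure (Algebra.adjoin ℝ (Set.range e) : Set C(K, ℝ)) := hf
  exact closure_minimal hle (Submodule.isClosed_topologicalClosure _) hf'

/-- The universal approximation theorem: a neural network with a continuous sigmoidal activation
function approximates any continuous map uniformly on a compact set. -/
theorem exists_neuralNet_forall_dist_lt (hφ : IsSigmoidal φ) {K : Set (Fin k → ℝ)}
    (hK : IsCompact K) {p : ℕ} (f : (Fin k → ℝ) → Fin p → ℝ) (hf : Continuous f) {ε : ℝ}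
    (hε : 0 < ε) : ∃ N : NeuralNet k p, ∀ z ∈ K, dist (N.eval φ z) (f z) < ε := by
  have : CompactSpace K := isCompact_iff_compactSpace.1 hK
  have h : ∀ j : Fin p, ∃ g ∈ ridgeSpan hφ.continuous K,
      dist (⟨fun x : K => f x j, by fun_prop⟩ : C(K, ℝ)) g < ε := by
    intro j
    have : (⟨fun x : K => f x j, by fun_prop⟩ : C(K, ℝ))
        ∈ closure (ridgeSpan hφ.continuous K : Set C(K, ℝ)) := by
      rw [← Submodule.topologicalClosure_coe, topologicalClosure_ridgeSpan hφ K]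
      trivial
    exact Metric.mem_closure_iff.1 this ε hε
  choose g hg hgd using h
  obtain ⟨N, hN⟩ := exists_neuralNet_of_mem_ridgeSpan hφ.continuous K g hg
  refine ⟨N, fun z hz => (dist_pi_lt_iff hε).2 fun j => ?_⟩
  rw [hN ⟨z, hz⟩ j, dist_comm]
  exact (ContinuousMap.dist_apply_le_dist (f := (⟨fun x : K => f x j, by fun_prop⟩ : C(K, ℝ)))
    (g := g j) ⟨z, hz⟩).trans_lt (hgd j)

theorem NeuralNet.continuous_eval (hφ : Continuous φ) {p : ℕ} (N : NeuralNet k p) :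
    Continuous (N.eval φ) := by
  unfold NeuralNet.eval
  fun_prop

end UniversalApproximation

/-! ### Networks and softmax networks approximating measurable functions -/

section ApproximationInMeasure

variable {φ : ℝ → ℝ} {k : ℕ}

/-- Bounded measurable functions are almost everywhere limits of neural networks. -/
theorem exists_neuralNet_tendsto_ae (hφ : IsSigmoidal φ) (μ : Measure (Fin k → ℝ))
    [IsFiniteMeasure μ] {p : ℕ} (g : (Fin k → ℝ) → Fin p → ℝ) (hg : Measurable g) (B : ℝ)
    (hB : ∀ x, ‖g x‖ ≤ B) :
    ∃ N : ℕ → NeuralNet k p, ∀ᵐ x ∂μ, Tendsto (fun i => (N i).eval φ x) atTop (𝓝 (g x)) := by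
  have hgL : MemLp g 1 μ := MemLp.of_bound hg.aestronglyMeasurable B (Eventually.of_forall hB)
  have hε : ∀ i : ℕ, (((i : ENNReal) + 1)⁻¹) ≠ 0 := fun i => by simp
  choose f hf _ using fun i : ℕ => hgL.exists_boundedContinuous_eLpNorm_sub_le (by simp) (hε i)
  have hfm : TendstoInMeasure μ (fun i => (f i : (Fin k → ℝ) → Fin p → ℝ)) atTop g := by
    refine tendstoInMeasure_of_tendsto_eLpNorm (p := 1) one_ne_zero
      (fun i => (f i).continuous.aestronglyMeasurable) hg.aestronglyMeasurable ?_
    refine tendsto_of_tendsto_of_tendsto_of_le_of_le tendsto_const_nhds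
      (?_ : Tendsto (fun i : ℕ => ((i : ENNReal) + 1)⁻¹) atTop (𝓝 0)) (fun _ => zero_le) ?_
    · have := (tendsto_add_atTop_iff_nat 1).2 ENNReal.tendsto_inv_nat_nhds_zero
      simpa using this
    · intro i
      simp only
      rw [eLpNorm_sub_comm]
      exact hf i
  obtain ⟨ns, -, hns⟩ := hfm.exists_seq_tendsto_ae
  -- Accuracy 1/(i+1) on the ball of radius i: every fixed x lies in all but finitely many of these
  -- balls.
  choose N hN using fun i : ℕ => exists_neuralNet_forall_dist_lt hφ
    (isCompact_closedBall (0 : Fin k → ℝ) (i : ℝ)) (f (ns i)) (f (ns i)).continuous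
    (Nat.one_div_pos_of_nat (α := ℝ) (n := i))
  refine ⟨N, ?_⟩
  filter_upwards [hns] with x hx
  refine hx.congr_dist ?_
  refine squeeze_zero' (Eventually.of_forall fun _ => dist_nonneg) ?_
    (tendsto_one_div_add_atTop_nhds_zero_nat (𝕜 := ℝ))
  filter_upwards [eventually_ge_atTop ⌈‖x‖⌉₊] with i hi
  rw [dist_comm]
  exact (hN i x (by simpa using (Nat.le_ceil _).trans (Nat.cast_le.2 hi))).le

theorem continuous_softmax {d : ℕ} : Continuous (softmax (d := d)) := by
  rcases Nat.eq_zero_or_pos d with rfl | hd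
  · exact continuous_of_const fun x y => Subsingleton.elim _ _
  · have : Nonempty (Fin d) := ⟨⟨0, hd⟩⟩
    refine continuous_pi fun j => ?_
    unfold softmax
    refine Continuous.div (by fun_prop) (by fun_prop) fun v => ?_
    exact (Finset.sum_pos (fun i _ => Real.exp_pos _) Finset.univ_nonempty).ne'

theorem softmax_pos {d : ℕ} (v : Fin d → ℝ) (j : Fin d) : 0 < softmax v j :=
  div_pos (Real.exp_pos _) (Finset.sum_pos (fun _ _ => Real.exp_pos _) ⟨j, Finset.mem_univ j⟩)

theorem sum_softmax {d : ℕ} [NeZero d] (v : Fin d → ℝ) : ∑ j, softmax v j = 1 := by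
  unfold softmax
  rw [← Finset.sum_div]
  exact div_self (Finset.sum_pos (fun i _ => Real.exp_pos _) Finset.univ_nonempty).ne'

theorem softmax_log {d : ℕ} {c : Fin d → ℝ} (hc : ∀ j, 0 < c j) (hsum : ∑ j, c j = 1) :
    softmax (fun j => Real.log (c j)) = c := by
  ext j
  simp [softmax, Real.exp_log (hc _), hsum]

/-- Measurable probability vectors that are bounded away from zero are approximated in measure by
softmax networks. -/
theorem exists_neuralNet_measure_softmax_le (hφ : IsSigmoidal φ) (μ : Measure (Fin k → ℝ))
    [IsFiniteMeasure μ] {d : ℕ} (c : (Fin k → ℝ) → Fin d → ℝ) (hc : Measurable c) {δ : ℝ}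
    (hδ : 0 < δ) (hδc : ∀ x j, δ ≤ c x j) (hsum : ∀ x, ∑ j, c x j = 1) {ε : ℝ} (hε : 0 < ε) :
    ∃ N : NeuralNet k d,
      μ {x | ε ≤ dist (softmax (N.eval φ x)) (c x)} ≤ ENNReal.ofReal ε := by
  have hpos : ∀ x j, 0 < c x j := fun x j => hδ.trans_le (hδc x j)
  have hle : ∀ x j, c x j ≤ 1 := fun x j => by
    rw [← hsum x]
    exact Finset.single_le_sum (fun i _ => (hpos x i).le) (Finset.mem_univ j)
  have hm : Measurable fun x j => Real.log (c x j) :=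
    measurable_pi_iff.2 fun j => Real.measurable_log.comp (measurable_pi_iff.1 hc j)
  obtain ⟨N, hN⟩ := exists_neuralNet_tendsto_ae hφ μ (fun x j => Real.log (c x j)) hm
    |Real.log δ| fun x => by
      refine (pi_norm_le_iff_of_nonneg (abs_nonneg _)).2 fun j => ?_
      rw [Real.norm_eq_abs, abs_of_nonpos (Real.log_nonpos (hpos x j).le (hle x j)),
        abs_of_nonpos (Real.log_nonpos hδ.le ((hδc x j).trans (hle x j)))]
      exact neg_le_neg (Real.log_le_log hδ (hδc x j))
  have hN' : ∀ᵐ x ∂μ, Tendsto (fun i => softmax ((N i).eval φ x)) atTop (𝓝 (c x)) := by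
    filter_upwards [hN] with x hx
    have := (continuous_softmax.tendsto _).comp hx
    rwa [softmax_log (hpos x) (hsum x)] at this
  have h := tendstoInMeasure_of_tendsto_ae (fun i => (continuous_softmax.comp
    ((N i).continuous_eval hφ.continuous)).aestronglyMeasurable) hN'
  have h2 := (tendstoInMeasure_iff_dist.1 h ε hε).eventually_le_const
    (ENNReal.ofReal_pos.2 hε)
  obtain ⟨i, hi⟩ := h2.exists
  exact ⟨N i, hi⟩

end ApproximationInMeasure

/-! ### Monotone functions as limits of sigmoid mixtures -/

section SigmoidMixture

/-- Every nonempty open set of reals carries a sequence of finer and finer sorted grids. -/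
theorem exists_grid {I : Set ℝ} (hI : IsOpen I) (hne : I.Nonempty) :
    ∃ b : (n : ℕ) → Fin (n + 1) → ℝ, (∀ n, StrictMono (b n)) ∧ (∀ n j, b n j ∈ I) ∧
      ∀ V, IsOpen V → (V ∩ I).Nonempty → ∀ᶠ n in atTop, ∃ i, b n i ∈ V := by
  let D : Set ℝ := I ∩ Set.range ((↑) : ℚ → ℝ)
  have hDc : D.Countable := (Set.countable_range _).mono Set.inter_subset_right
  have hDi : D.Infinite := by
    intro hfin
    have hIinf : I.Infinite := by
      obtain ⟨x, hx⟩ := hne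
      exact infinite_of_mem_nhds x (hI.mem_nhds hx)
    -- Removing finitely many rationals from I leaves a nonempty open set, which contains a further
    -- rational.
    obtain ⟨q, hq⟩ := Rat.isDenseEmbedding_coe_real.dense.exists_mem_open
      (hI.sdiff hfin.isClosed) (hIinf.sdiff hfin).nonempty
    exact hq.2 ⟨hq.1, q, rfl⟩
  have : Countable D := hDc.to_subtype
  have : Infinite D := hDi.to_subtype
  obtain ⟨hD⟩ := nonempty_denumerable D
  let e : ℕ ≃ D := (Denumerable.eqv D).symm
  -- The n-th grid consists of the first n + 1 points in an enumeration of the rationals of I, so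
  -- the grids are nested.
  let s : ℕ → Finset ℝ := fun n =>
    (Finset.range (n + 1)).map ⟨fun i => (e i : ℝ), Subtype.val_injective.comp e.injective⟩
  have hs : ∀ n, (s n).card = n + 1 := fun n => by simp [s]
  refine ⟨fun n => (s n).orderEmbOfFin (hs n), fun n => ((s n).orderEmbOfFin (hs n)).strictMono,
    fun n j => ?_, fun V hV hVI => ?_⟩
  · have := (s n).orderEmbOfFin_mem (hs n) j
    obtain ⟨i, -, hi⟩ := Finset.mem_map.1 this
    change (s n).orderEmbOfFin (hs n) j ∈ I
    rw [← hi]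
    exact (e i).2.1
  · obtain ⟨q, hq⟩ := Rat.isDenseEmbedding_coe_real.dense.exists_mem_open (hV.inter hI) hVI
    obtain ⟨i, hi⟩ := e.surjective ⟨q, hq.2, q, rfl⟩
    filter_upwards [eventually_ge_atTop i] with n hn
    have hmem : (q : ℝ) ∈ Set.range ((s n).orderEmbOfFin (hs n)) := by
      rw [Finset.range_orderEmbOfFin]
      refine Finset.mem_coe.2 (Finset.mem_map.2 ⟨i, Finset.mem_range.2 (by omega), ?_⟩)
      simp [hi]
    obtain ⟨j, hj⟩ := hmem
    exact ⟨j, by rw [hj]; exact hq.1⟩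

/-- The values `a` at the grid points, preceded by `0` and followed by `1`. -/
def stepValue {n : ℕ} (a : Fin (n + 1) → ℝ) (i : ℕ) : ℝ :=
  if i = 0 then 0 else if h : i < n + 1 then a ⟨i, h⟩ else 1

/-- The weights of a sigmoid mixture that interpolates the values `a` on a grid, mixed with a
small amount of the uniform weights. -/
noncomputable def stepWeight {n : ℕ} (a : Fin (n + 1) → ℝ) (j : Fin (n + 1)) : ℝ :=
  (1 - 1 / ((n : ℝ) + 1)) * (stepValue a (j + 1) - stepValue a j)
    + 1 / ((n : ℝ) + 1) * (1 / ((n : ℝ) + 1))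

variable {n : ℕ} {a : Fin (n + 1) → ℝ}

theorem monotone_stepValue (ha : Monotone a) (h01 : ∀ i, a i ∈ Set.Icc (0 : ℝ) 1) :
    Monotone (stepValue a) := by
  intro i j hij
  unfold stepValue
  split_ifs with h1 h2 h3 h4 h5 h6 h7
  · exact le_rfl
  · exact (h01 _).1
  · exact zero_le_one
  · omega
  · exact ha (by simpa using hij)
  · exact (h01 _).2
  · omega
  · omega
  · exact le_rfl

/-- Only an inequality, since index 0 carries the value 0 in place of `a 0`. With
`le_stepValue_succ` it brackets `a i` between consecutive partial sums of the increments. -/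
theorem stepValue_le (h01 : ∀ i, a i ∈ Set.Icc (0 : ℝ) 1) (i : Fin (n + 1)) :
    stepValue a i ≤ a i := by
  unfold stepValue
  split_ifs with h1
  · exact (h01 i).1
  · exact le_rfl
  · exact absurd i.2 ‹_›

theorem le_stepValue_succ (ha : Monotone a) (h01 : ∀ i, a i ∈ Set.Icc (0 : ℝ) 1)
    (i : Fin (n + 1)) : a i ≤ stepValue a (i + 1) := by
  unfold stepValue
  rw [if_neg (Nat.succ_ne_zero _)]
  split_ifs with h
  · exact ha (Fin.le_def.2 (by simp))
  · exact (h01 i).2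

theorem sum_stepValue_sub (a : Fin (n + 1) → ℝ) :
    ∑ j : Fin (n + 1), (stepValue a (j + 1) - stepValue a j) = 1 := by
  rw [Fin.sum_univ_eq_sum_range (fun j => stepValue a (j + 1) - stepValue a j),
    Finset.sum_range_sub]
  simp [stepValue]

theorem sum_stepWeight (a : Fin (n + 1) → ℝ) : ∑ j, stepWeight a j = 1 := by
  unfold stepWeight
  rw [Finset.sum_add_distrib, ← Finset.mul_sum, sum_stepValue_sub]
  simp
  field_simp
  ring

/-- The floor comes from the uniform part and is what keeps the logarithms of the weights bounded.
-/
theorem le_stepWeight (ha : Monotone a) (h01 : ∀ i, a i ∈ Set.Icc (0 : ℝ) 1) (j : Fin (n + 1)) :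
    1 / ((n : ℝ) + 1) * (1 / ((n : ℝ) + 1)) ≤ stepWeight a j := by
  unfold stepWeight
  have h1 : 1 / ((n : ℝ) + 1) ≤ 1 := by
    rw [div_le_one (by positivity)]
    linarith [n.cast_nonneg (α := ℝ)]
  have h2 := monotone_stepValue ha h01 (Nat.le_succ j)
  have := mul_nonneg (sub_nonneg.2 h1) (sub_nonneg.2 h2)
  simpa using this

/-- Sigmoids centered before grid point i are bounded by 1 and their increments telescope to at most
`a i`; the others are at most c, against total weight 1. -/
theorem sum_stepValue_mul_le (ha : Monotone a) (h01 : ∀ i, a i ∈ Set.Icc (0 : ℝ) 1)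
    {g : Fin (n + 1) → ℝ} (hg : ∀ j, g j ≤ 1) {c : ℝ} (hc : 0 ≤ c) (i : Fin (n + 1))
    (hgc : ∀ j, i ≤ j → g j ≤ c) :
    ∑ j : Fin (n + 1), (stepValue a (j + 1) - stepValue a j) * g j ≤ a i + c := by
  have hinc : ∀ j : ℕ, 0 ≤ stepValue a (j + 1) - stepValue a j := fun j =>
    sub_nonneg.2 (monotone_stepValue ha h01 (Nat.le_succ j))
  calc ∑ j : Fin (n + 1), (stepValue a (j + 1) - stepValue a j) * g j
      ≤ ∑ j : Fin (n + 1), ((if (j : ℕ) < i then stepValue a (j + 1) - stepValue a j else 0)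
          + (stepValue a (j + 1) - stepValue a j) * c) := by
        refine Finset.sum_le_sum fun j _ => ?_
        split_ifs with h
        · nlinarith [hinc j, hg j]
        · rw [zero_add]
          exact mul_le_mul_of_nonneg_left (hgc j (not_lt.1 h)) (hinc j)
    _ = stepValue a i + c := by
        rw [Finset.sum_add_distrib, ← Finset.sum_mul, sum_stepValue_sub, one_mul,
          Fin.sum_univ_eq_sum_range
            (fun j => if j < (i : ℕ) then stepValue a (j + 1) - stepValue a j else 0),
          ← Finset.sum_filter]
        have : (Finset.range (n + 1)).filter (· < (i : ℕ)) = Finset.range i := by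
          ext j
          have := i.2
          simp only [Finset.mem_filter, Finset.mem_range]
          omega
        rw [this, Finset.sum_range_sub]
        simp [stepValue]
    _ ≤ a i + c := by linarith [stepValue_le h01 i]

/-- Keep only the terms up to i: their increments telescope to at least `a i`, and each sigmoid
there is at least c. -/
theorem le_sum_stepValue_mul (ha : Monotone a) (h01 : ∀ i, a i ∈ Set.Icc (0 : ℝ) 1)
    {g : Fin (n + 1) → ℝ} (hg : ∀ j, 0 ≤ g j) {c : ℝ} (hc : 0 ≤ c) (i : Fin (n + 1))
    (hgc : ∀ j, j ≤ i → c ≤ g j) :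
    a i * c ≤ ∑ j : Fin (n + 1), (stepValue a (j + 1) - stepValue a j) * g j := by
  have hinc : ∀ j : ℕ, 0 ≤ stepValue a (j + 1) - stepValue a j := fun j =>
    sub_nonneg.2 (monotone_stepValue ha h01 (Nat.le_succ j))
  calc a i * c ≤ stepValue a (i + 1) * c :=
        mul_le_mul_of_nonneg_right (le_stepValue_succ ha h01 i) hc
    _ = ∑ j : Fin (n + 1),
          (if (j : ℕ) < i + 1 then stepValue a (j + 1) - stepValue a j else 0) * c := by
        rw [← Finset.sum_mul, Fin.sum_univ_eq_sum_range
            (fun j => if j < (i : ℕ) + 1 then stepValue a (j + 1) - stepValue a j else 0),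
          ← Finset.sum_filter]
        have : (Finset.range (n + 1)).filter (· < (i : ℕ) + 1) = Finset.range (i + 1) := by
          ext j
          have := i.2
          simp only [Finset.mem_filter, Finset.mem_range]
          omega
        rw [this, Finset.sum_range_sub]
        simp [stepValue]
    _ ≤ _ := by
        refine Finset.sum_le_sum fun j _ => ?_
        split_ifs with h
        · exact mul_le_mul_of_nonneg_left (hgc j (Nat.lt_succ_iff.1 h)) (hinc j)
        · rw [zero_mul]
          exact mul_nonneg (hinc j) (hg j)

/-- Sigmoid mixtures on finer and finer grids recover a monotone function at its points of
continuity. -/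
theorem tendsto_sum_stepWeight_mul_sigmoid {I : Set ℝ} (hI : IsOpen I)
    {b : (n : ℕ) → Fin (n + 1) → ℝ} (hb : ∀ n, StrictMono (b n))
    (hdense : ∀ V, IsOpen V → (V ∩ I).Nonempty → ∀ᶠ n in atTop, ∃ i, b n i ∈ V)
    {S : ℝ → ℝ} (hS : Monotone S) (hS01 : ∀ s, S s ∈ Set.Icc (0 : ℝ) 1) {s : ℝ} (hs : s ∈ I)
    (hc : ContinuousAt S s) :
    Tendsto (fun n : ℕ => ∑ j : Fin (n + 1), stepWeight (fun i => S (b n i)) j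
      * Real.sigmoid ((s - b n j) / (1 / ((n : ℝ) + 1)))) atTop (𝓝 (S s)) := by
  have hmono : ∀ n, Monotone fun i => S (b n i) := fun n => hS.comp (hb n).monotone
  have h01 : ∀ n i, S (b n i) ∈ Set.Icc (0 : ℝ) 1 := fun n i => hS01 _
  let f : ℕ → ℝ := fun n => ∑ j : Fin (n + 1),
    (stepValue (fun i => S (b n i)) (j + 1) - stepValue (fun i => S (b n i)) j)
      * Real.sigmoid ((s - b n j) / (1 / ((n : ℝ) + 1)))
  have hτ : Tendsto (fun n : ℕ => (n : ℝ) + 1) atTop atTop :=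
    tendsto_atTop_add_const_right _ _ tendsto_natCast_atTop_atTop
  have hgap : ∀ δ > 0, ∃ t, s < t ∧ t < s + δ ∧ t ∈ I := by
    intro δ hδ
    have : ∀ᶠ t in 𝓝[>] s, t ∈ I ∧ t < s + δ :=
      nhdsWithin_le_nhds ((hI.eventually_mem hs).and (Iio_mem_nhds (by linarith)))
    obtain ⟨t, ht, hst⟩ := (this.and self_mem_nhdsWithin).exists
    exact ⟨t, hst, ht.2, ht.1⟩
  have hgap' : ∀ δ > 0, ∃ t, t < s ∧ s - δ < t ∧ t ∈ I := by
    intro δ hδ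
    have : ∀ᶠ t in 𝓝[<] s, t ∈ I ∧ s - δ < t :=
      nhdsWithin_le_nhds ((hI.eventually_mem hs).and (Ioi_mem_nhds (by linarith)))
    obtain ⟨t, ht, hst⟩ := (this.and self_mem_nhdsWithin).exists
    exact ⟨t, hst, ht.2, ht.1⟩
  have hf : Tendsto f atTop (𝓝 (S s)) := by
    refine tendsto_order.2 ⟨fun y hy => ?_, fun y hy => ?_⟩
    · obtain ⟨δ, hδ, hδy⟩ := Metric.eventually_nhds_iff.1 (hc.eventually (Ioi_mem_nhds hy))
      -- The point t keeps the grid away from s: a grid point in (s - δ/2, (s + t)/2) is at distance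
      -- at least (s - t)/2 from s, so its sigmoid and all earlier ones tend to 1. The upper bound
      -- mirrors this on the right of s.
      obtain ⟨t, hts, hδt, htI⟩ := hgap' (δ / 2) (by linarith)
      have hSt : y < S (s - δ / 2) := hδy (by rw [Real.dist_eq, abs_lt]; constructor <;> linarith)
      have hlim : Tendsto (fun n : ℕ => S (s - δ / 2) * Real.sigmoid (((s - t) / 2)
          * ((n : ℝ) + 1))) atTop (𝓝 (S (s - δ / 2) * 1)) :=
        (Real.tendsto_sigmoid_atTop.comp (hτ.const_mul_atTop (by linarith))).const_mul _
      rw [mul_one] at hlim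
      filter_upwards [hlim.eventually (Ioi_mem_nhds hSt), hdense (Set.Ioo (s - δ / 2) ((s + t) / 2))
        isOpen_Ioo ⟨t, ⟨by linarith, by linarith⟩, htI⟩] with n hn ⟨i, hi⟩
      refine hn.trans_le ?_
      refine le_trans ?_ (le_sum_stepValue_mul (hmono n) (h01 n)
        (fun j => Real.sigmoid_nonneg _) (c := Real.sigmoid (((s - t) / 2) * ((n : ℝ) + 1)))
        (Real.sigmoid_nonneg _) i fun j hj => ?_)
      · exact mul_le_mul_of_nonneg_right (hS hi.1.le) (Real.sigmoid_nonneg _)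
      · refine Real.sigmoid_le ?_
        rw [div_div_eq_mul_div, div_one]
        refine mul_le_mul_of_nonneg_right ?_ (by positivity)
        linarith [(hb n).monotone hj, hi.2]
    · obtain ⟨δ, hδ, hδy⟩ := Metric.eventually_nhds_iff.1 (hc.eventually (Iio_mem_nhds hy))
      obtain ⟨t, hts, hδt, htI⟩ := hgap (δ / 2) (by linarith)
      have hSt : S (s + δ / 2) < y := hδy (by rw [Real.dist_eq, abs_lt]; constructor <;> linarith)
      have hlim : Tendsto (fun n : ℕ => S (s + δ / 2) + Real.sigmoid (((s - t) / 2)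
          * ((n : ℝ) + 1))) atTop (𝓝 (S (s + δ / 2) + 0)) :=
        (Real.tendsto_sigmoid_atBot.comp (hτ.const_mul_atTop_of_neg (by linarith))).const_add _
      rw [add_zero] at hlim
      filter_upwards [hlim.eventually (Iio_mem_nhds hSt), hdense (Set.Ioo ((s + t) / 2) (s + δ / 2))
        isOpen_Ioo ⟨t, ⟨by linarith, by linarith⟩, htI⟩] with n hn ⟨i, hi⟩
      refine lt_of_le_of_lt ?_ hn
      refine (sum_stepValue_mul_le (hmono n) (h01 n) (fun j => Real.sigmoid_le_one _)
        (c := Real.sigmoid (((s - t) / 2) * ((n : ℝ) + 1))) (Real.sigmoid_nonneg _) i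
        fun j hj => ?_).trans ?_
      · refine Real.sigmoid_le ?_
        rw [div_div_eq_mul_div, div_one]
        refine mul_le_mul_of_nonneg_right ?_ (by positivity)
        linarith [(hb n).monotone hj, hi.1]
      · exact add_le_add_left (hS hi.2.le) _
  have hη : Tendsto (fun n : ℕ => 1 / ((n : ℝ) + 1)) atTop (𝓝 0) :=
    tendsto_one_div_add_atTop_nhds_zero_nat
  let u : ℕ → ℝ := fun n => 1 / ((n : ℝ) + 1) * ∑ j : Fin (n + 1),
    (1 / ((n : ℝ) + 1)) * Real.sigmoid ((s - b n j) / (1 / ((n : ℝ) + 1)))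
  have hu : Tendsto u atTop (𝓝 0) := by
    refine squeeze_zero (fun n => ?_) (fun n => ?_) hη
    · exact mul_nonneg (by positivity) (Finset.sum_nonneg fun j _ =>
        mul_nonneg (by positivity) (Real.sigmoid_nonneg _))
    · refine mul_le_of_le_one_right (by positivity) ?_
      calc _ ≤ ∑ j : Fin (n + 1), 1 / ((n : ℝ) + 1) := Finset.sum_le_sum fun j _ =>
            mul_le_of_le_one_right (by positivity) (Real.sigmoid_le_one _)
        _ = 1 := by simp; field_simp
  have := ((tendsto_const_nhds (x := (1 : ℝ))).sub hη).mul hf |>.add hu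
  rw [sub_zero, one_mul, add_zero] at this
  refine this.congr fun n => ?_
  simp only [f, u, stepWeight, add_mul, Finset.sum_add_distrib, Finset.mul_sum, mul_assoc]

end SigmoidMixture

/-! ### Approximation of one coordinate in measure -/

section CoordinateTransformer

open ProbabilityTheory

variable {φ : ℝ → ℝ} {k : ℕ}

/-- The factor d means that, with d = n + 1 units, weight errors must be of order smaller than 1/n;
the tolerance 1/(n+1)² is chosen for this. -/
theorem abs_sum_mul_sigmoid_sub_le {d : ℕ} (v c s : Fin d → ℝ) :
    |∑ j, v j * Real.sigmoid (s j) - ∑ j, c j * Real.sigmoid (s j)| ≤ d * dist v c := by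
  rw [← Finset.sum_sub_distrib]
  refine (Finset.abs_sum_le_sum_abs _ _).trans ?_
  calc _ ≤ ∑ _j : Fin d, dist v c := Finset.sum_le_sum fun j _ => by
        rw [← sub_mul, abs_mul, abs_of_nonneg (Real.sigmoid_nonneg _), ← Real.dist_eq]
        exact (mul_le_of_le_one_right dist_nonneg (Real.sigmoid_le_one _)).trans
          (dist_le_pi_dist v c j)
    _ = _ := by simp

/-- A measurable family of distribution functions `S x`, evaluated at a random point whose
conditional laws have no atoms, is a limit in measure of sigmoid mixtures with constant centers
and scales, the weights being the softmax of a neural network. -/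
theorem exists_neuralNet_tendstoInMeasure (hφ : IsSigmoidal φ)
    (ρ : Measure ((Fin k → ℝ) × ℝ)) [IsProbabilityMeasure ρ]
    (hρ : ∀ᵐ x ∂ρ.fst, NullSingletonClass (ρ.condKernel x))
    {S : (Fin k → ℝ) → ℝ → ℝ} (hSm : Measurable (Function.uncurry S))
    (hS : ∀ x, Monotone (S x)) (hS01 : ∀ x s, S x s ∈ Set.Icc (0 : ℝ) 1)
    {I : Set ℝ} (hI : IsOpen I) (hne : I.Nonempty) (hρI : ∀ᵐ q ∂ρ, q.2 ∈ I) :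
    ∃ (N : (n : ℕ) → NeuralNet k (n + 1)) (b : (n : ℕ) → Fin (n + 1) → ℝ),
      (∀ n j, b n j ∈ I) ∧
      TendstoInMeasure ρ (fun n q => ∑ j, softmax ((N n).eval φ q.1) j
        * Real.sigmoid ((q.2 - b n j) / (1 / ((n : ℝ) + 1)))) atTop (fun q => S q.1 q.2) := by
  obtain ⟨b, hb, hbI, hdense⟩ := exists_grid hI hne
  let c : (n : ℕ) → (Fin k → ℝ) → Fin (n + 1) → ℝ := fun n x =>
    stepWeight fun i => S x (b n i)
  have hSx : ∀ s, Measurable fun x => S x s := fun s => hSm.comp measurable_prodMk_right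
  have hcm : ∀ n, Measurable (c n) := by
    intro n
    refine measurable_pi_iff.2 fun j => ?_
    have h : ∀ i : ℕ, Measurable fun x => stepValue (fun i => S x (b n i)) i := by
      intro i
      unfold stepValue
      split_ifs
      · exact measurable_const
      · exact hSx _
      · exact measurable_const
    exact (((h _).sub (h _)).const_mul _).add_const _
  have hpos : ∀ n : ℕ, (0 : ℝ) < 1 / ((n : ℝ) + 1) := fun n => by positivity
  choose N hN using fun n : ℕ => exists_neuralNet_measure_softmax_le hφ ρ.fst (c n) (hcm n)
    (mul_pos (hpos n) (hpos n))
    (fun x j => le_stepWeight ((hS x).comp (hb n).monotone) (fun i => hS01 x _) j)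
    (fun x => sum_stepWeight _) (mul_pos (hpos n) (hpos n))
  refine ⟨N, b, hbI, ?_⟩
  let σ : (n : ℕ) → (Fin k → ℝ) × ℝ → Fin (n + 1) → ℝ := fun n q j =>
    (q.2 - b n j) / (1 / ((n : ℝ) + 1))
  have hsig : ∀ n j, Measurable fun q => Real.sigmoid (σ n q j) := fun n j =>
    continuous_sigmoid.measurable.comp ((measurable_snd.sub_const _).div_const _)
  let f : ℕ → (Fin k → ℝ) × ℝ → ℝ := fun n q => ∑ j, c n q.1 j * Real.sigmoid (σ n q j)
  have hfm : ∀ n, Measurable (f n) := fun n => Finset.measurable_fun_sum _ fun j _ =>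
    ((measurable_pi_iff.1 (hcm n) j).comp measurable_fst).mul (hsig n j)
  have hae : ∀ᵐ q ∂ρ, Tendsto (fun n => f n q) atTop (𝓝 (S q.1 q.2)) := by
    -- After disintegration the prefix is fixed, and the countably many jumps of `S x` are null for
    -- the atomless conditional law.
    rw [← ρ.disintegrate ρ.condKernel] at hρI ⊢
    refine Measure.ae_compProd_of_ae_ae (measurableSet_tendsto_fun hfm hSm) ?_
    filter_upwards [hρ, Measure.ae_ae_of_ae_compProd hρI] with x hx hxI
    have hcont : ∀ᵐ s ∂(ρ.condKernel x), ContinuousAt (S x) s :=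
      (hS x).countable_not_continuousAt.measure_zero _
    filter_upwards [hcont, hxI] with s hs hsI
    exact tendsto_sum_stepWeight_mul_sigmoid hI hb hdense (hS x) (hS01 x) hsI hs
  have hfS := tendstoInMeasure_of_tendsto_ae (fun n => (hfm n).aestronglyMeasurable) hae
  rw [tendstoInMeasure_iff_dist] at hfS ⊢
  intro ε hε
  have hinv : Tendsto (fun n : ℕ => 1 / ((n : ℝ) + 1)) atTop (𝓝 0) :=
    tendsto_one_div_add_atTop_nhds_zero_nat
  have hsmall : Tendsto (fun n : ℕ => ENNReal.ofReal (1 / ((n : ℝ) + 1) * (1 / ((n : ℝ) + 1))))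
      atTop (𝓝 0) := by
    have := ENNReal.tendsto_ofReal (hinv.mul hinv)
    simpa using this
  have hsum := hsmall.add (hfS (ε / 2) (by linarith))
  rw [add_zero] at hsum
  refine tendsto_of_tendsto_of_tendsto_of_le_of_le' tendsto_const_nhds hsum
    (Eventually.of_forall fun _ => zero_le) ?_
  filter_upwards [hinv.eventually (Iio_mem_nhds (show 0 < ε / 2 by linarith))] with n hn
  have hmeas : MeasurableSet {x | 1 / ((n : ℝ) + 1) * (1 / ((n : ℝ) + 1))
      ≤ dist (softmax ((N n).eval φ x)) (c n x)} :=
    measurableSet_le measurable_const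
      ((continuous_softmax.comp ((N n).continuous_eval hφ.continuous)).measurable.dist (hcm n))
  have hN' := hN n
  rw [Measure.fst_apply hmeas] at hN'
  refine (measure_mono ?_).trans ((measure_union_le _ _).trans (add_le_add hN' le_rfl))
  intro q hq
  by_contra hcon
  simp only [Set.mem_union, Set.mem_preimage, Set.mem_ofPred_eq, not_or, not_le] at hcon hq
  have h1 := abs_sum_mul_sigmoid_sub_le (softmax ((N n).eval φ q.1)) (c n q.1) (σ n q)
  have h2 : ((n + 1 : ℕ) : ℝ) * dist (softmax ((N n).eval φ q.1)) (c n q.1)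
      < 1 / ((n : ℝ) + 1) := by
    have := mul_lt_mul_of_pos_left hcon.1 (show (0 : ℝ) < ((n + 1 : ℕ) : ℝ) by positivity)
    refine this.trans_eq ?_
    push_cast
    field_simp
  have h3 := dist_triangle (∑ j, softmax ((N n).eval φ q.1) j * Real.sigmoid (σ n q j)) (f n q)
    (S q.1 q.2)
  have h4 : dist (∑ j, softmax ((N n).eval φ q.1) j * Real.sigmoid (σ n q j)) (f n q)
      < ε / 2 := (h1.trans_lt h2).trans hn
  have h5 := hq.trans h3
  linarith [hcon.2]

end CoordinateTransformer

/-! ### Distribution functions, quantiles and monotone rearrangement on the line -/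

section Quantile

open ProbabilityTheory

theorem continuous_cdf (η : Measure ℝ) [IsProbabilityMeasure η] [NullSingletonClass η] :
    Continuous (cdf η) := by
  refine continuous_iff_continuousAt.2 fun a => ?_
  have h : (cdf η).measure {a} = 0 := by rw [measure_cdf]; exact measure_singleton a
  rw [StieltjesFunction.measure_singleton, ENNReal.ofReal_eq_zero] at h
  rw [(monotone_cdf η).continuousAt_iff_leftLim_eq_rightLim, StieltjesFunction.rightLim_eq]
  exact le_antisymm ((monotone_cdf η).leftLim_le le_rfl) (by linarith)

/-- The distribution function of an atomless law, evaluated at a random point with that law, is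
uniformly distributed. -/
theorem measure_cdf_le (η : Measure ℝ) [IsProbabilityMeasure η] [NullSingletonClass η] {c : ℝ}
    (h0 : 0 ≤ c) (h1 : c < 1) : η {s | cdf η s ≤ c} = ENNReal.ofReal c := by
  have hrange : ∀ c', 0 < c' → c' < 1 → ∃ a, cdf η a = c' := fun c' h h' =>
    mem_range_of_exists_le_of_exists_ge (continuous_cdf η)
      ((tendsto_cdf_atBot η).eventually_le_const h).exists
      ((tendsto_cdf_atTop η).eventually_const_le h').exists
  refine le_antisymm ?_ ?_
  -- Levels c' > c are used because the distribution function may be flat at height c, or may never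
  -- attain it when c = 0.
  · have hev : ∀ᶠ c' in 𝓝[>] c, η {s | cdf η s ≤ c} ≤ ENNReal.ofReal c' := by
      filter_upwards [Ioo_mem_nhdsGT h1] with c' hc'
      obtain ⟨a, ha⟩ := hrange c' (h0.trans_lt hc'.1) hc'.2
      rw [← ha, ofReal_cdf]
      refine measure_mono fun s hs => ?_
      by_contra has
      have := monotone_cdf η (not_le.1 has).le
      have hs' : cdf η s ≤ c := hs
      linarith [hc'.1]
    exact ge_of_tendsto (ENNReal.continuous_ofReal.continuousWithinAt.tendsto) hev
  · rcases h0.eq_or_lt with rfl | h0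
    · simp
    · obtain ⟨a, ha⟩ := hrange c h0 h1
      rw [← ha, ofReal_cdf]
      exact measure_mono fun s hs => monotone_cdf η hs

/-- The quantile function, truncated to the unit interval. -/
noncomputable def unitQuantile (η : Measure ℝ) (u : ℝ) : ℝ :=
  sInf {v | v ∈ Set.Icc (0 : ℝ) 1 ∧ (v = 1 ∨ u ≤ cdf η v)}

variable (η : Measure ℝ)

theorem one_mem_quantileSet (u : ℝ) :
    (1 : ℝ) ∈ {v | v ∈ Set.Icc (0 : ℝ) 1 ∧ (v = 1 ∨ u ≤ cdf η v)} :=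
  ⟨⟨zero_le_one, le_rfl⟩, Or.inl rfl⟩

theorem bddBelow_quantileSet (u : ℝ) :
    BddBelow {v | v ∈ Set.Icc (0 : ℝ) 1 ∧ (v = 1 ∨ u ≤ cdf η v)} :=
  ⟨0, fun _ hv => hv.1.1⟩

theorem unitQuantile_mem_Icc (u : ℝ) : unitQuantile η u ∈ Set.Icc (0 : ℝ) 1 :=
  ⟨le_csInf ⟨1, one_mem_quantileSet η u⟩ fun _ hv => hv.1.1,
    csInf_le (bddBelow_quantileSet η u) (one_mem_quantileSet η u)⟩

theorem monotone_unitQuantile : Monotone (unitQuantile η) := fun u u' h =>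
  csInf_le_csInf (bddBelow_quantileSet η u) ⟨1, one_mem_quantileSet η u'⟩
    fun _ hv => ⟨hv.1, hv.2.imp_right h.trans⟩

/-- Quantile and distribution function form a Galois connection; right continuity is what turns the
infimum into an attained inequality. The restriction v < 1 avoids the point 1 put into the set by
hand. -/
theorem unitQuantile_le_iff {u v : ℝ} (h0 : 0 ≤ v) (h1 : v < 1) :
    unitQuantile η u ≤ v ↔ u ≤ cdf η v := by
  refine ⟨fun h => ?_, fun h => csInf_le (bddBelow_quantileSet η u) ⟨⟨h0, h1.le⟩, Or.inr h⟩⟩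
  have hc : Tendsto (cdf η) (𝓝[>] v) (𝓝 (cdf η v)) :=
    ((cdf η).right_continuous v).mono Set.Ioi_subset_Ici_self
  refine ge_of_tendsto hc ?_
  filter_upwards [Ioo_mem_nhdsGT h1] with v' hv'
  obtain ⟨w, hw, hwv⟩ := exists_lt_of_csInf_lt ⟨1, one_mem_quantileSet η u⟩ (h.trans_lt hv'.1)
  rcases hw.2 with rfl | hw
  · exact absurd hwv (not_lt.2 hv'.2.le)
  · exact hw.trans (monotone_cdf η hwv.le)

/-- The monotone rearrangement pushes an atomless law forward to a prescribed law on `(0, 1)`. -/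
theorem map_unitQuantile_cdf (η η' : Measure ℝ) [IsProbabilityMeasure η] [NullSingletonClass η]
    [IsProbabilityMeasure η'] (hη' : ∀ᵐ v ∂η', v ∈ Set.Ioo (0 : ℝ) 1) :
    η.map (fun s => unitQuantile η' (cdf η s)) = η' := by
  have hm : Measurable fun s => unitQuantile η' (cdf η s) :=
    ((monotone_unitQuantile η').comp (monotone_cdf η)).measurable
  have := Measure.isProbabilityMeasure_map (μ := η) hm.aemeasurable
  refine Measure.ext_of_Iic _ _ fun v => ?_
  rw [Measure.map_apply hm measurableSet_Iic]
  rcases lt_or_ge v 0 with h0 | h0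
  · have h1 : (fun s => unitQuantile η' (cdf η s)) ⁻¹' Set.Iic v = ∅ :=
      Set.eq_empty_of_forall_notMem fun s hs =>
        absurd ((unitQuantile_mem_Icc η' _).1.trans hs) (not_le.2 h0)
    rw [h1, measure_empty]
    refine (measure_eq_zero_iff_ae_notMem.2 ?_).symm
    filter_upwards [hη'] with w hw hwv
    exact absurd (hw.1.trans_le hwv) (not_lt.2 h0.le)
  rcases lt_or_ge v 1 with h1 | h1
  · have h2 : (fun s => unitQuantile η' (cdf η s)) ⁻¹' Set.Iic v
        = {s | cdf η s ≤ cdf η' v} := by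
      ext s
      exact unitQuantile_le_iff η' h0 h1
    rw [h2]
    -- Level 1 is excluded in `measure_cdf_le` and is treated separately.
    rcases (cdf_le_one η' v).lt_or_eq with h3 | h3
    · rw [measure_cdf_le η (cdf_nonneg η' v) h3, ofReal_cdf]
    · have h4 : {s | cdf η s ≤ cdf η' v} = Set.univ :=
        Set.eq_univ_of_forall fun s => (cdf_le_one η s).trans h3.ge
      rw [h4, measure_univ, ← ofReal_cdf, h3, ENNReal.ofReal_one]
  · have h2 : (fun s => unitQuantile η' (cdf η s)) ⁻¹' Set.Iic v = Set.univ :=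
      Set.eq_univ_of_forall fun s => (unitQuantile_mem_Icc η' _).2.trans h1
    rw [h2, measure_univ]
    refine ((prob_compl_eq_zero_iff measurableSet_Iic).1 (measure_eq_zero_iff_ae_notMem.2 ?_)).symm
    filter_upwards [hη'] with w hw hwv
    exact hwv (hw.2.le.trans h1)

end Quantile

/-! ### Rearrangement of conditional laws -/

section ConditionalTransport

open ProbabilityTheory

variable {α β : Type*} [MeasurableSpace α] [MeasurableSpace β]

theorem measurable_kernel_cdf (κ : Kernel α ℝ) [IsMarkovKernel κ] :
    Measurable fun q : α × ℝ => cdf (κ q.1) q.2 := by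
  have h : MeasurableSet {p : (α × ℝ) × ℝ | p.2 ≤ p.1.2} :=
    measurableSet_le measurable_snd measurable_fst.snd
  have h2 := Kernel.measurable_kernel_prodMk_left (κ := κ.comap Prod.fst measurable_fst) h
  have h3 : (fun q : α × ℝ => cdf (κ q.1) q.2) = fun q : α × ℝ =>
      (κ q.1 (Set.Iic q.2)).toReal := by
    ext q
    rw [cdf_eq_real]
    rfl
  rw [h3]
  exact Measurable.ennreal_toReal h2

/-- Through the Galois connection, sublevel sets of the quantile become sets described by the
jointly measurable distribution function. -/
theorem measurable_kernel_unitQuantile (κ : Kernel β ℝ) [IsMarkovKernel κ] :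
    Measurable fun q : β × ℝ => unitQuantile (κ q.1) q.2 := by
  refine measurable_of_Iic fun v => ?_
  rcases lt_or_ge v 0 with h0 | h0
  · have h1 : (fun q : β × ℝ => unitQuantile (κ q.1) q.2) ⁻¹' Set.Iic v = ∅ :=
      Set.eq_empty_of_forall_notMem fun s hs =>
        absurd ((unitQuantile_mem_Icc _ _).1.trans hs) (not_le.2 h0)
    rw [h1]
    exact MeasurableSet.empty
  rcases lt_or_ge v 1 with h1 | h1
  · have h2 : (fun q : β × ℝ => unitQuantile (κ q.1) q.2) ⁻¹' Set.Iic v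
        = {q | q.2 ≤ cdf (κ q.1) v} := by
      ext q
      exact unitQuantile_le_iff _ h0 h1
    rw [h2]
    exact measurableSet_le measurable_snd
      ((measurable_kernel_cdf κ).comp (measurable_fst.prodMk measurable_const))
  · have h2 : (fun q : β × ℝ => unitQuantile (κ q.1) q.2) ⁻¹' Set.Iic v = Set.univ :=
      Set.eq_univ_of_forall fun s => (unitQuantile_mem_Icc _ _).2.trans h1
    rw [h2]
    exact MeasurableSet.univ

/-- The conditional monotone rearrangement of `κ x` to `κ' (T x)`. -/
noncomputable def conditionalTransport (κ : Kernel α ℝ) (κ' : Kernel β ℝ) (T : α → β) (x : α)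
    (s : ℝ) : ℝ :=
  unitQuantile (κ' (T x)) (cdf (κ x) s)

theorem measurable_conditionalTransport (κ : Kernel α ℝ) [IsMarkovKernel κ] (κ' : Kernel β ℝ)
    [IsMarkovKernel κ'] {T : α → β} (hT : Measurable T) :
    Measurable (Function.uncurry (conditionalTransport κ κ' T)) :=
  (measurable_kernel_unitQuantile κ').comp
    ((hT.comp measurable_fst).prodMk (measurable_kernel_cdf κ))

/-- If `T` transports `μ` to `μ'`, then the conditional rearrangement extends it to a triangular
transport from `μ ⊗ₘ κ` to `μ' ⊗ₘ κ'`. -/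
theorem map_conditionalTransport {μ : Measure α} [IsProbabilityMeasure μ] {κ : Kernel α ℝ}
    [IsMarkovKernel κ] (hκ : ∀ᵐ x ∂μ, NullSingletonClass (κ x)) {μ' : Measure β}
    [IsProbabilityMeasure μ'] {κ' : Kernel β ℝ} [IsMarkovKernel κ']
    (hκ' : ∀ᵐ q ∂(μ' ⊗ₘ κ'), q.2 ∈ Set.Ioo (0 : ℝ) 1)
    {T : α → β} (hT : Measurable T) (hTμ : μ.map T = μ') :
    (μ ⊗ₘ κ).map (fun q => (T q.1, conditionalTransport κ κ' T q.1 q.2)) = μ' ⊗ₘ κ' := by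
  have hSm := measurable_conditionalTransport κ κ' hT
  have hae : ∀ᵐ y ∂μ', ∀ᵐ v ∂(κ' y), v ∈ Set.Ioo (0 : ℝ) 1 :=
    Measure.ae_ae_of_ae_compProd hκ'
  rw [← hTμ] at hae
  have hae' := ae_of_ae_map hT.aemeasurable hae
  have hm : Measurable fun q : α × ℝ => (T q.1, conditionalTransport κ κ' T q.1 q.2) :=
    (hT.comp measurable_fst).prodMk hSm
  refine Measure.ext fun D hD => ?_
  -- Both sides become integrals over x of fibre measures, which agree for almost every x by
  -- `map_unitQuantile_cdf`.
  rw [Measure.map_apply hm hD, Measure.compProd_apply (hm hD), Measure.compProd_apply hD, ← hTμ,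
    lintegral_map (Kernel.measurable_kernel_prodMk_left hD) hT]
  refine lintegral_congr_ae ((hκ.and hae').mono fun x hx => ?_)
  obtain ⟨hx, hx'⟩ := hx
  have hSx : Measurable (conditionalTransport κ κ' T x) :=
    hSm.of_uncurry_left
  have h : (κ x).map (conditionalTransport κ κ' T x) = κ' (T x) :=
    map_unitQuantile_cdf (κ x) (κ' (T x)) hx'
  change κ x _ = κ' (T x) (Prod.mk (T x) ⁻¹' D)
  rw [← h, Measure.map_apply hSx (measurable_prodMk_left hD)]
  rfl

/-- Each `κ x` has countably many atoms, so the pairs (x, s) with s an atom of `κ x` are null for γ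
× Lebesgue, hence for `μ ⊗ₘ κ`. Almost every `κ x` thus gives mass 0 to the set of its own atoms,
and so has none. -/
theorem ae_nullSingletonClass_of_compProd {μ : Measure α} [SFinite μ] {κ : Kernel α ℝ}
    [IsMarkovKernel κ] {γ : Measure α} [SFinite γ] (h : μ ⊗ₘ κ ≪ γ.prod volume) :
    ∀ᵐ x ∂μ, NullSingletonClass (κ x) := by
  have hT : MeasurableSet {p : (α × ℝ) × ℝ | p.2 = p.1.2} :=
    measurableSet_eq_fun measurable_snd measurable_fst.snd
  have hm : Measurable fun q : α × ℝ => κ q.1 {q.2} :=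
    Kernel.measurable_kernel_prodMk_left
      (κ := κ.comap Prod.fst (measurable_fst (β := ℝ))) hT
  have hcount : ∀ x, {s | κ x {s} ≠ 0}.Countable := by
    intro x
    have := Measure.countable_meas_pos_of_disjoint_iUnion (μ := κ x)
      (As := fun s : ℝ => {s}) (fun s => measurableSet_singleton s)
      (fun s t hst => by simpa using hst)
    simpa [pos_iff_ne_zero] using this
  have h1 : ∀ᵐ q ∂(γ.prod volume), κ q.1 {q.2} = 0 := by
    refine (Measure.ae_prod_iff_ae_ae (measurableSet_eq_fun hm measurable_const)).2
      (Eventually.of_forall fun x => ?_)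
    exact (hcount x).measure_zero volume
  filter_upwards [Measure.ae_ae_of_ae_compProd (h.ae_le h1)] with x hx
  refine ⟨fun s => ?_⟩
  by_contra hs
  have h3 : κ x {s | κ x {s} ≠ 0} = 0 := hx
  exact hs (measure_mono_null (Set.singleton_subset_iff.2 hs) h3)

end ConditionalTransport

/-! ### The Knothe–Rosenblatt map -/

section TriangularTransport

open ProbabilityTheory

/-- The first coordinates and the last one. -/
def splitLast (m : ℕ) : (Fin (m + 1) → ℝ) ≃ᵐ (Fin m → ℝ) × ℝ :=
  (MeasurableEquiv.piFinSuccAbove (fun _ => ℝ) (Fin.last m)).trans MeasurableEquiv.prodComm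

theorem splitLast_apply {m : ℕ} (x : Fin (m + 1) → ℝ) :
    splitLast m x = (fun i => x i.castSucc, x (Fin.last m)) := by
  ext i <;> simp [splitLast] <;> rfl

theorem measurePreserving_splitLast (m : ℕ) :
    MeasurePreserving (splitLast m) volume (volume.prod volume) :=
  Measure.measurePreserving_swap.comp
    (volume_preserving_piFinSuccAbove (fun _ => ℝ) (Fin.last m))

/-- The coordinate `x t` together with the coordinates before it. -/
def prefixPair {m : ℕ} (t : Fin m) (x : Fin m → ℝ) : (Fin (t : ℕ) → ℝ) × ℝ :=
  (prefixOf x t, x t)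

theorem measurable_prefixOf {m : ℕ} (t : Fin m) : Measurable fun x : Fin m → ℝ => prefixOf x t :=
  measurable_pi_iff.2 fun _ => measurable_pi_apply _

theorem measurable_prefixPair {m : ℕ} (t : Fin m) : Measurable (prefixPair t) :=
  (measurable_prefixOf t).prodMk (measurable_pi_apply t)

/-- Forgetting a coordinate turns Lebesgue measure into one with values 0 and ∞, so only absolute
continuity survives; later coordinates are dropped one at a time. -/
theorem map_prefixPair_volume_absolutelyContinuous : ∀ {m : ℕ} (t : Fin m),
    (volume : Measure (Fin m → ℝ)).map (prefixPair t) ≪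
      (volume : Measure (Fin (t : ℕ) → ℝ)).prod (volume : Measure ℝ) := by
  intro m
  induction m with
  | zero => exact fun t => t.elim0
  | succ m ih =>
    intro t
    induction t using Fin.lastCases with
    | last =>
      have h : (prefixPair (Fin.last m) : (Fin (m + 1) → ℝ) → _) = splitLast m :=
        funext fun x => (splitLast_apply x).symm
      rw [h]
      exact (measurePreserving_splitLast m).map_eq.absolutelyContinuous
    | cast t =>
      have h : (prefixPair t.castSucc : (Fin (m + 1) → ℝ) → _)
          = prefixPair t ∘ (Prod.fst ∘ splitLast m) := by
        funext x
        simp only [Function.comp, splitLast_apply]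
        rfl
      have hq : Measure.QuasiMeasurePreserving (Prod.fst ∘ splitLast m) volume volume :=
        Measure.quasiMeasurePreserving_fst.comp
          (measurePreserving_splitLast m).quasiMeasurePreserving
      rw [h, ← Measure.map_map (measurable_prefixPair t) hq.measurable]
      exact (hq.absolutelyContinuous.map (measurable_prefixPair t)).trans (ih t)

theorem ae_nullSingletonClass_condKernel {α : Type*} [MeasurableSpace α] (ρ : Measure (α × ℝ))
    [IsProbabilityMeasure ρ] {γ : Measure α} [SFinite γ] (h : ρ ≪ γ.prod volume) :
    ∀ᵐ x ∂ρ.fst, NullSingletonClass (ρ.condKernel x) :=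
  ae_nullSingletonClass_of_compProd (γ := γ) (by rwa [ρ.disintegrate ρ.condKernel])

theorem ae_nullSingletonClass_condKernel_prefixPair {m : ℕ} {μ : Measure (Fin m → ℝ)}
    [IsProbabilityMeasure μ] (hμ : μ ≪ volume) (t : Fin m) :
    ∀ᵐ x ∂(μ.map (prefixPair t)).fst, NullSingletonClass ((μ.map (prefixPair t)).condKernel x) := by
  have := Measure.isProbabilityMeasure_map (μ := μ) (measurable_prefixPair t).aemeasurable
  exact ae_nullSingletonClass_condKernel _ ((hμ.map (measurable_prefixPair t)).trans
    (map_prefixPair_volume_absolutelyContinuous t))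

/-- The autoregressive map with coordinate functions `S`. -/
def autoregressive (S : (t : ℕ) → (Fin t → ℝ) → ℝ → ℝ) {m : ℕ} (x : Fin m → ℝ) : Fin m → ℝ :=
  fun t => S t (prefixOf x t) (x t)

theorem measurable_autoregressive {S : (t : ℕ) → (Fin t → ℝ) → ℝ → ℝ}
    (hS : ∀ t, Measurable (Function.uncurry (S t))) {m : ℕ} :
    Measurable (autoregressive S (m := m)) :=
  measurable_pi_iff.2 fun t => (hS t).comp (measurable_prefixPair t)

/-- The Knothe–Rosenblatt rearrangement: an absolutely continuous law is transported to any law on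
`(0, 1)^m` by a monotone autoregressive map. -/
theorem exists_autoregressive_map_eq : ∀ {m : ℕ} (μ ν : Measure (Fin m → ℝ))
    [IsProbabilityMeasure μ] [IsProbabilityMeasure ν], μ ≪ volume →
    (∀ᵐ y ∂ν, y ∈ Set.univ.pi fun _ => Set.Ioo (0 : ℝ) 1) →
    ∃ S : (t : ℕ) → (Fin t → ℝ) → ℝ → ℝ, (∀ t, Measurable (Function.uncurry (S t))) ∧
      (∀ t x, Monotone (S t x)) ∧ (∀ t x s, S t x s ∈ Set.Icc (0 : ℝ) 1) ∧
      μ.map (autoregressive S) = ν := by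
  intro m
  induction m with
  | zero =>
    intro μ ν _ _ _ _
    refine ⟨fun _ _ _ => 0, fun _ => measurable_const, fun _ _ => monotone_const,
      fun _ _ _ => ⟨le_rfl, zero_le_one⟩, ?_⟩
    have hm : Measurable (autoregressive (fun _ _ _ => 0) (m := 0)) :=
      measurable_autoregressive fun _ => measurable_const
    have := Measure.isProbabilityMeasure_map (μ := μ) hm.aemeasurable
    refine Measure.ext fun s _ => ?_
    rcases s.eq_empty_or_nonempty with rfl | hs
    · simp
    · rw [Subsingleton.eq_univ_of_nonempty hs, measure_univ, measure_univ]
  | succ m ih =>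
    intro μ ν _ _ hμ hν
    have hpm := (splitLast m).measurable
    have := Measure.isProbabilityMeasure_map (μ := μ) hpm.aemeasurable
    have := Measure.isProbabilityMeasure_map (μ := ν) hpm.aemeasurable
    set ρ := μ.map (splitLast m) with hρ
    set ρ' := ν.map (splitLast m) with hρ'
    have hρac : ρ ≪ (volume : Measure (Fin m → ℝ)).prod volume := by
      rw [← (measurePreserving_splitLast m).map_eq]
      exact hμ.map hpm
    have hcube : MeasurableSet (Set.univ.pi fun _ : Fin m => Set.Ioo (0 : ℝ) 1) :=
      MeasurableSet.univ_pi fun _ => measurableSet_Ioo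
    have hρ'1 : ∀ᵐ q ∂ρ', q.1 ∈ Set.univ.pi fun _ : Fin m => Set.Ioo (0 : ℝ) 1 := by
      refine (ae_map_iff hpm.aemeasurable (measurable_fst hcube)).2 ?_
      filter_upwards [hν] with y hy
      rw [splitLast_apply]
      exact fun t _ => hy _ trivial
    have hρ'2 : ∀ᵐ q ∂ρ', q.2 ∈ Set.Ioo (0 : ℝ) 1 := by
      refine (ae_map_iff hpm.aemeasurable (measurable_snd measurableSet_Ioo)).2 ?_
      filter_upwards [hν] with y hy
      rw [splitLast_apply]
      exact hy _ trivial
    obtain ⟨S, hSm, hSmono, hS01, hSmap⟩ := ih ρ.fst ρ'.fst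
      ((hρac.map measurable_fst).trans Measure.quasiMeasurePreserving_fst.absolutelyContinuous)
      ((ae_map_iff measurable_fst.aemeasurable hcube).2 hρ'1)
    have hT := measurable_autoregressive hSm (m := m)
    have hRm := measurable_conditionalTransport ρ.condKernel ρ'.condKernel hT
    set R := conditionalTransport ρ.condKernel ρ'.condKernel (autoregressive S) with hR
    have hRmap : ρ.map (fun q => (autoregressive S q.1, R q.1 q.2)) = ρ' := by
      have h := map_conditionalTransport (ae_nullSingletonClass_condKernel ρ hρac)
        (κ' := ρ'.condKernel) (μ' := ρ'.fst)
        (by rw [ρ'.disintegrate ρ'.condKernel]; exact hρ'2) hT hSmap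
      rwa [ρ.disintegrate ρ.condKernel, ρ'.disintegrate ρ'.condKernel] at h
    have hS'm : ∀ t, Measurable (Function.uncurry (Function.update S m R t)) := by
      intro t
      rcases eq_or_ne t m with rfl | h
      · rw [Function.update_self]
        exact hRm
      · rw [Function.update_of_ne h]
        exact hSm t
    -- The inductive map uses only positions below m, so position m is free for the conditional
    -- rearrangement of the last coordinate.
    refine ⟨Function.update S m R, hS'm, fun t => ?_, fun t => ?_, ?_⟩
    · rcases eq_or_ne t m with rfl | h
      · rw [Function.update_self]
        exact fun x => (monotone_unitQuantile _).comp (monotone_cdf _)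
      · rw [Function.update_of_ne h]
        exact hSmono t
    · rcases eq_or_ne t m with rfl | h
      · rw [Function.update_self]
        exact fun x s => unitQuantile_mem_Icc _ _
      · rw [Function.update_of_ne h]
        exact hS01 t
    · refine (splitLast m).map_measurableEquiv_injective ?_
      rw [Measure.map_map hpm (measurable_autoregressive hS'm), ← hρ', ← hRmap, hρ,
        Measure.map_map (g := fun q => (autoregressive S q.1, R q.1 q.2))
          ((hT.comp measurable_fst).prodMk hRm) hpm]
      congr 1
      funext x
      simp only [Function.comp, splitLast_apply]
      refine Prod.ext (funext fun t => ?_) ?_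
      · change Function.update S m R (t : ℕ) _ _ = S t _ _
        rw [Function.update_of_ne t.2.ne]
        rfl
      · change Function.update S m R m _ _ = R _ _
        rw [Function.update_self]
        rfl

end TriangularTransport

/-! ### Convergence in measure and in distribution under composition -/

section Convergence

variable {α : Type*} [MeasurableSpace α]

theorem TendstoInMeasure.comp_of_map {β E : Type*} [MeasurableSpace β] [EDist E] {μ : Measure α}
    {ψ : α → β} (hψ : AEMeasurable ψ μ) {f : ℕ → β → E} {g : β → E}
    (h : TendstoInMeasure (μ.map ψ) f atTop g) :
    TendstoInMeasure μ (fun n x => f n (ψ x)) atTop (fun x => g (ψ x)) := fun ε hε =>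
  tendsto_of_tendsto_of_tendsto_of_le_of_le tendsto_const_nhds (h ε hε) (fun _ => zero_le)
    fun _ => Measure.le_map_apply hψ _

theorem tendstoInMeasure_pi {m : ℕ} {μ : Measure α} {f : ℕ → α → Fin m → ℝ} {g : α → Fin m → ℝ}
    (h : ∀ t, TendstoInMeasure μ (fun n x => f n x t) atTop (fun x => g x t)) :
    TendstoInMeasure μ f atTop g := by
  rw [tendstoInMeasure_iff_dist]
  intro ε hε
  have hsum : Tendsto (fun n => ∑ t, μ {x | ε ≤ dist (f n x t) (g x t)}) atTop (𝓝 0) := by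
    simpa using tendsto_finsetSum Finset.univ fun t _ =>
      tendstoInMeasure_iff_dist.1 (h t) ε hε
  refine tendsto_of_tendsto_of_tendsto_of_le_of_le tendsto_const_nhds hsum (fun _ => zero_le)
    fun n => ?_
  refine (measure_mono fun x hx => ?_).trans (measure_iUnion_fintype_le μ _)
  by_contra hcon
  simp only [Set.mem_iUnion, Set.mem_ofPred_eq, not_exists, not_le] at hcon hx
  exact absurd ((dist_pi_lt_iff hε).2 hcon) (not_lt.2 hx)

/-- Every subsequence has a further one converging almost everywhere, and there continuity at the
limit point suffices. -/
theorem TendstoInMeasure.comp_of_ae_continuousAt {E F : Type*} [PseudoEMetricSpace E]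
    [PseudoEMetricSpace F] {μ : Measure α} [IsFiniteMeasure μ] {f : ℕ → α → E} {g : α → E}
    (h : TendstoInMeasure μ f atTop g) {L : E → F}
    (hm : ∀ n, AEStronglyMeasurable (fun x => L (f n x)) μ)
    (hL : ∀ᵐ x ∂μ, ContinuousAt L (g x)) :
    TendstoInMeasure μ (fun n x => L (f n x)) atTop (fun x => L (g x)) := by
  refine (exists_seq_tendstoInMeasure_atTop_iff hm).2 fun ns hns => ?_
  obtain ⟨ns', hns', hlim⟩ := (h.comp hns.tendsto_atTop).exists_seq_tendsto_ae
  refine ⟨ns', hns', ?_⟩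
  filter_upwards [hlim, hL] with x hx hLx
  exact hLx.tendsto.comp hx

/-- Convergence in distribution on the law of `X` gives convergence in distribution of the images
of `X`. -/
theorem tendstoInDistribution_comp {Ω Ω' E : Type*} [MeasurableSpace Ω] [MeasurableSpace Ω']
    [MeasurableSpace E] [TopologicalSpace E] [OpensMeasurableSpace E] {P : Measure Ω}
    [IsProbabilityMeasure P] {P' : Measure Ω'} [IsProbabilityMeasure P'] {X : Ω → E}
    (hX : AEMeasurable X P) {Y : Ω' → E} (hY : AEMeasurable Y P') {F : ℕ → E → E}
    (hF : ∀ n, Measurable (F n)) {G : E → E} [IsProbabilityMeasure (P.map X)]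
    (h : TendstoInDistribution F atTop G (fun _ => P.map X) (P.map X))
    (hG : (P.map X).map G = P'.map Y) :
    TendstoInDistribution (fun n ω => F n (X ω)) atTop Y (fun _ => P) P' := by
  refine ⟨fun n => (hF n).comp_aemeasurable hX, hY, ?_⟩
  have h1 : ∀ n, P.map (fun ω => F n (X ω)) = (P.map X).map (F n) := fun n =>
    (AEMeasurable.map_map_of_aemeasurable (hF n).aemeasurable hX).symm
  simp only [h1, ← hG]
  exact h.tendsto

theorem measurable_logit : Measurable logit :=
  Real.measurable_log.comp (measurable_id.div (measurable_const.sub measurable_id))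

theorem continuousAt_logit {p : ℝ} (hp : p ∈ Set.Ioo (0 : ℝ) 1) : ContinuousAt logit p := by
  have h1 : 1 - p ≠ 0 := by linarith [hp.2]
  have h2 : p / (1 - p) ≠ 0 := div_ne_zero hp.1.ne' h1
  unfold logit
  exact (continuousAt_id.div (continuousAt_const.sub continuousAt_id) h1).log h2

end Convergence

/-! ### Deep sigmoidal flows with constant centers and scales -/

section Flow

variable {φ : ℝ → ℝ}

/-- The neural network with constant output `c`. -/
def NeuralNet.const (k : ℕ) {p : ℕ} (c : Fin p → ℝ) : NeuralNet k p where
  width := 0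
  innerWeight i := i.elim0
  innerBias i := i.elim0
  outerWeight _ i := i.elim0
  outerBias := c

theorem NeuralNet.eval_const (k : ℕ) {p : ℕ} (c : Fin p → ℝ) (z : Fin k → ℝ) :
    (NeuralNet.const k c).eval φ z = c := by
  ext j
  simp only [NeuralNet.eval, NeuralNet.const, add_eq_right]
  exact Finset.sum_eq_zero fun i _ => i.elim0

variable {m : ℕ}

/-- The conditioner with weight networks `N`, constant centers `b` and constant scale `τ`. -/
noncomputable def constConditioner {d : ℕ} (N : (t : Fin m) → NeuralNet (t : ℕ) d)
    (b : Fin m → Fin d → ℝ) (τ : ℝ) : Conditioner m d where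
  weightNet := N
  centerNet t := NeuralNet.const _ (b t)
  scaleNet _ := NeuralNet.const _ fun _ => Real.log τ

theorem constConditioner_b {d : ℕ} (N : (t : Fin m) → NeuralNet (t : ℕ) d)
    (b : Fin m → Fin d → ℝ) (τ : ℝ) (t : Fin m) (x : Fin m → ℝ) :
    (constConditioner N b τ).b φ t x = b t :=
  NeuralNet.eval_const _ _ _

theorem constConditioner_τ {d : ℕ} (N : (t : Fin m) → NeuralNet (t : ℕ) d)
    (b : Fin m → Fin d → ℝ) {τ : ℝ} (hτ : 0 < τ) (t : Fin m) (x : Fin m → ℝ) (j : Fin d) :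
    (constConditioner N b τ).τ φ t x j = τ := by
  simp [Conditioner.τ, constConditioner, NeuralNet.eval_const, Real.exp_log hτ]

theorem Conditioner.continuous_preLogit (hφ : Continuous φ) {d : ℕ} (C : Conditioner m d) :
    Continuous (C.preLogit φ) := by
  have hp : ∀ t : Fin m, Continuous fun x : Fin m → ℝ => prefixOf x t := fun t =>
    continuous_pi fun i => continuous_apply _
  have he : ∀ (t : Fin m) (N : NeuralNet (t : ℕ) d) (j : Fin d),
      Continuous fun x => N.eval φ (prefixOf x t) j := fun t N j =>
    (continuous_apply j).comp ((N.continuous_eval hφ).comp (hp t))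
  refine continuous_pi fun t => continuous_finsetSum _ fun j _ => Continuous.mul ?_ ?_
  · exact (continuous_apply j).comp
      (continuous_softmax.comp (((C.weightNet t).continuous_eval hφ).comp (hp t)))
  · exact continuous_sigmoid.comp (((continuous_apply t).sub (he t _ j)).div
      (Real.continuous_exp.comp (he t _ j)) fun x => (Real.exp_pos _).ne')

theorem Conditioner.measurable_flow (hφ : Continuous φ) {d : ℕ} (C : Conditioner m d) :
    Measurable (C.flow φ) :=
  measurable_pi_iff.2 fun t => measurable_logit.comp
    ((measurable_pi_apply t).comp (C.continuous_preLogit hφ).measurable)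

/-- An absolutely continuous law `μ` on an open box is transported in measure to any monotone
autoregressive image by the pre-logits of flows with constant centers and scales. -/
theorem exists_conditioner_tendstoInMeasure_preLogit (hφ : IsSigmoidal φ)
    (μ : Measure (Fin m → ℝ)) [IsProbabilityMeasure μ] (hμ : μ ≪ volume) {I : Set ℝ}
    (hI : IsOpen I) (hμI : ∀ᵐ x ∂μ, ∀ t, x t ∈ I)
    {S : (t : ℕ) → (Fin t → ℝ) → ℝ → ℝ} (hSm : ∀ t, Measurable (Function.uncurry (S t)))
    (hS : ∀ t x, Monotone (S t x)) (hS01 : ∀ t x s, S t x s ∈ Set.Icc (0 : ℝ) 1) :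
    ∃ (N : (n : ℕ) → (t : Fin m) → NeuralNet (t : ℕ) (n + 1))
      (b : (n : ℕ) → Fin m → Fin (n + 1) → ℝ), (∀ n t j, b n t j ∈ I) ∧
      TendstoInMeasure μ
        (fun n => (constConditioner (N n) (b n) (1 / ((n : ℝ) + 1))).preLogit φ) atTop
        (autoregressive S) := by
  have key : ∀ t : Fin m, ∃ (N : (n : ℕ) → NeuralNet (t : ℕ) (n + 1))
      (b : (n : ℕ) → Fin (n + 1) → ℝ), (∀ n j, b n j ∈ I) ∧
      TendstoInMeasure (μ.map (prefixPair t)) (fun n q => ∑ j, softmax ((N n).eval φ q.1) j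
        * Real.sigmoid ((q.2 - b n j) / (1 / ((n : ℝ) + 1)))) atTop (fun q => S t q.1 q.2) := by
    intro t
    have := Measure.isProbabilityMeasure_map (μ := μ) (measurable_prefixPair t).aemeasurable
    -- A probability measure charges some point; its t-th coordinate shows that I is nonempty.
    obtain ⟨x, hx⟩ := hμI.exists
    refine exists_neuralNet_tendstoInMeasure hφ _ (ae_nullSingletonClass_condKernel_prefixPair hμ t)
      (hSm t) (hS t) (hS01 t) hI ⟨_, hx t⟩ ?_
    exact (ae_map_iff (measurable_prefixPair t).aemeasurable
      (measurable_snd hI.measurableSet)).2 (hμI.mono fun x hx => hx t)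
  choose N b hb hN using key
  refine ⟨fun n t => N t n, fun n t => b t n, fun n t => hb t n, tendstoInMeasure_pi fun t => ?_⟩
  have h := TendstoInMeasure.comp_of_map (measurable_prefixPair t).aemeasurable (hN t)
  refine h.congr_left fun n => Eventually.of_forall fun x => ?_
  refine Finset.sum_congr rfl fun j _ => ?_
  rw [constConditioner_b, constConditioner_τ _ _ (by positivity)]
  rfl

end Flow

/-! ### The main theorem -/

theorem HasPositiveContinuousDensity.map_absolutelyContinuous {Ω : Type*} [MeasurableSpace Ω]
    {m : ℕ} {X : Ω → Fin m → ℝ} {P : Measure Ω} {U : Set (Fin m → ℝ)}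
    (hX : HasPositiveContinuousDensity X P U) : P.map X ≪ volume.restrict U := by
  obtain ⟨-, p, -, -, hp⟩ := hX
  rw [hp]
  exact withDensity_absolutelyContinuous _ _

theorem mainTheorem1 {m : ℕ} (φ : ℝ → ℝ) (hφ : IsSigmoidal φ)
    {Ω Ω' : Type*} [MeasurableSpace Ω] [MeasurableSpace Ω']
    (P : Measure Ω) [IsProbabilityMeasure P] (P' : Measure Ω') [IsProbabilityMeasure P']
    (U : Set (Fin m → ℝ)) (hU : IsOpen U)
    (X : Ω → Fin m → ℝ) (hX : HasPositiveContinuousDensity X P U)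
    (Y : Ω' → Fin m → ℝ) (hY : HasPositiveContinuousDensity Y P' Set.univ)
    (r₀ r₁ : EReal) (hr : ∀ x ∈ U, ∀ t, r₀ < (x t : EReal) ∧ (x t : EReal) < r₁) :
    ∃ C : (n : ℕ) → Conditioner m (n + 1),
      (∀ n t, ∀ x ∈ U,
        (∀ j, 0 < (C n).w φ t x j) ∧ ∑ j, (C n).w φ t x j = 1 ∧
        (∀ j, r₀ < ((C n).b φ t x j : EReal) ∧ ((C n).b φ t x j : EReal) < r₁) ∧
        (∀ j, 0 < (C n).τ φ t x j)) ∧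
      (∀ n, ∃ B : ℝ, ∀ t, ∀ x ∈ U, ∀ j, (C n).τ φ t x j ≤ B) ∧
      TendstoInDistribution (fun n ω => (C n).flow φ (X ω)) atTop Y (fun _ => P) P' := by
  have hXm : AEMeasurable X P := hX.1
  have hYm : AEMeasurable Y P' := hY.1
  set μ := P.map X with hμ
  have : IsProbabilityMeasure μ := Measure.isProbabilityMeasure_map hXm
  have hμU : μ ≪ volume.restrict U := hX.map_absolutelyContinuous
  have hμvol : μ ≪ volume := hμU.trans Measure.absolutelyContinuous_restrict
  let I : Set ℝ := {s | r₀ < (s : EReal) ∧ (s : EReal) < r₁}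
  have hI : IsOpen I := (isOpen_Ioo (a := r₀) (b := r₁)).preimage continuous_coe_real_ereal
  have hXU : ∀ᵐ x ∂μ, x ∈ U := hμU.ae_le (ae_restrict_mem hU.measurableSet)
  have hμI : ∀ᵐ x ∂μ, ∀ t, x t ∈ I := hXU.mono fun x hx => hr x hx
  let σ : (Fin m → ℝ) → Fin m → ℝ := fun y t => Real.sigmoid (y t)
  let L : (Fin m → ℝ) → Fin m → ℝ := fun y t => logit (y t)
  have hσ : Measurable σ := measurable_pi_iff.2 fun t =>
    continuous_sigmoid.measurable.comp (measurable_pi_apply t)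
  have hL : Measurable L := measurable_pi_iff.2 fun t =>
    measurable_logit.comp (measurable_pi_apply t)
  have hLσ : L ∘ σ = id := funext fun y => funext fun t => logit_sigmoid _
  have hσY : AEMeasurable (σ ∘ Y) P' := hσ.comp_aemeasurable hYm
  have := Measure.isProbabilityMeasure_map hσY
  have hcube : MeasurableSet (Set.univ.pi fun _ : Fin m => Set.Ioo (0 : ℝ) 1) :=
    MeasurableSet.univ_pi fun _ => measurableSet_Ioo
  have hν : ∀ᵐ y ∂(P'.map (σ ∘ Y)), y ∈ Set.univ.pi fun _ => Set.Ioo (0 : ℝ) 1 :=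
    (ae_map_iff hσY hcube).2 (Eventually.of_forall fun ω t _ =>
      ⟨Real.sigmoid_pos _, Real.sigmoid_lt_one _⟩)
  obtain ⟨S, hSm, hS, hS01, hSmap⟩ := exists_autoregressive_map_eq μ (P'.map (σ ∘ Y)) hμvol hν
  have hSa := measurable_autoregressive hSm (m := m)
  obtain ⟨N, b, hb, hN⟩ :=
    exists_conditioner_tendstoInMeasure_preLogit hφ μ hμvol hI hμI hSm hS hS01
  have hτ : ∀ n : ℕ, (0 : ℝ) < 1 / ((n : ℝ) + 1) := fun n => by positivity
  let C : (n : ℕ) → Conditioner m (n + 1) := fun n =>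
    constConditioner (N n) (b n) (1 / ((n : ℝ) + 1))
  refine ⟨C, fun n t x _ => ⟨fun j => softmax_pos _ j, sum_softmax _, fun j => ?_,
    fun j => Real.exp_pos _⟩, fun n => ⟨1 / ((n : ℝ) + 1), fun t x _ j =>
      (constConditioner_τ _ _ (hτ n) t x j).le⟩, ?_⟩
  · rw [constConditioner_b]
    exact hb n t j
  have hflow : ∀ n, Measurable ((C n).flow φ) := fun n => (C n).measurable_flow hφ.continuous
  -- The coordinates of S are only known to lie in [0,1], and the logit is discontinuous at 0 and 1;
  -- that S(x) almost surely lies in the open cube is read off from its law, that of σ(Y).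
  rw [← hSmap] at hν
  have hcont : ∀ᵐ x ∂μ, ContinuousAt L (autoregressive S x) :=
    (ae_of_ae_map hSa.aemeasurable hν).mono fun x hx => continuousAt_pi.2 fun t =>
      ContinuousAt.comp (f := fun y : Fin m → ℝ => y t) (continuousAt_logit (hx t trivial))
        (continuous_apply t).continuousAt
  have hlim : TendstoInMeasure μ (fun n => (C n).flow φ) atTop (fun x => L (autoregressive S x)) :=
    TendstoInMeasure.comp_of_ae_continuousAt (L := L) (f := fun n => (C n).preLogit φ)
      (g := autoregressive S) hN (fun n => (hflow n).aestronglyMeasurable) hcont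
  have hdist := hlim.tendstoInDistribution fun n => (hflow n).aemeasurable
  have hlaw : μ.map (fun x => L (autoregressive S x)) = P'.map Y := by
    have h1 : μ.map (fun x => L (autoregressive S x)) = (μ.map (autoregressive S)).map L :=
      (Measure.map_map hL hSa).symm
    rw [h1, hSmap, AEMeasurable.map_map_of_aemeasurable hL.aemeasurable hσY,
      ← Function.comp_assoc, hLσ, Function.id_comp]
  exact tendstoInDistribution_comp hXm hYm hflow hdist hlaw
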